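/- For $s\in\mathbb C$ with $\Re(s)>1$ let $\zeta(s)=\sum_{n\ge1} n^{-s}$ and $\bar\zeta(s)=\sum_{n\ge1}(-1)^{n-1}n^{-s}$. Let $H_n=\sum_{k=1}^n \frac1k$, let $\psi=\Gamma'/\Gamma$ be the digamma function on $\mathbb C\setminus\{0,-1,-2,\dots\}$, let $\gamma$ be the Euler–Mascheroni constant, $i=\sqrt{-1}$, and let $\lfloor\cdot\rfloor$ denote the integer part. Then for every positive integer $p$ the four infinite series below converge absolutely, and $$ \begin{aligned} &\left(1+(-1)^{p+1}\right)\sum_{n=1}^\infty \frac{\pi H_n}{n^p\sinh(n\pi)}(-1)^n-\left(p+(-1)^{p+1}\right)\sum_{n=1}^\infty\frac{\pi}{n^{p+1}\sinh(n\pi)}(-1)^n-\sum_{n=1}^\infty\frac{\pi^2\cosh(n\pi)}{n^p\sinh^2(n\pi)}(-1)^n\\ &+\sum_{n=1}^\infty\frac{(-1)^n\pi}{n^p\sinh(n\pi)}\,i^{p+1}\left(\psi(ni)+(-1)^{p+1}\psi(-ni)+\left(1+(-1)^{p+1}\right)\gamma\right)\\ &+\zeta(p+2)\left\{\left(1-2^{-p-1}\right)\left(1+(-1)^p\right)\left(1+(-1)^{\lfloor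 p/2\rfloor+1}\right)-1\right\}\\ &-2\sum_{\substack{2n_1+n_2=p+1\\ n_1,n_2\ge1}}\left(1+(-1)^{n_1}\right)\bar\zeta(2n_1)\,\zeta(n_2+1)\\ &+2\left(1+(-1)^p\right)\sum_{\substack{2n_1+2n_2=p+2\\ n_1,n_2\ge1}}(-1)^{n_2}\,\bar\zeta(2n_1)\,\bar\zeta(2n_2)\\ &-4\sum_{\substack{2n_1+2n_2+n_3=p+1\\ n_1,n_2,n_3\ge1}}(-1)^{n_2}\,\bar\zeta(2n_1)\,\bar\zeta(2n_2)\,\zeta(n_3+1)=0, \end{aligned} $$ where the finite sums run over positive integers (empty sums are $0$). -/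

import Mathlib

/-- The alternating Riemann zeta function, as its Dirichlet series
`∑_{n ≥ 1} (-1)^(n-1) / n^s`, summed unconditionally (so to be used for `Re s > 1`; below it occurs
only at positive even integers). -/
noncomputable def altZeta (s : ℂ) : ℂ :=
  ∑' n : ℕ+, (-1 : ℂ) ^ ((n : ℕ) - 1) / (n : ℂ) ^ s

/-- `(-1)^n π H_n / (n^p sinh(nπ))`. -/
noncomputable def harmonicTerm (p : ℕ) (n : ℕ+) : ℂ :=
  Real.pi * (harmonic (n : ℕ) : ℂ) / ((n : ℂ) ^ p * Complex.sinh (n * Real.pi)) * (-1) ^ (n : ℕ)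

/-- `(-1)^n π / (n^(p+1) sinh(nπ))`. -/
noncomputable def cschTerm (p : ℕ) (n : ℕ+) : ℂ :=
  Real.pi / ((n : ℂ) ^ (p + 1) * Complex.sinh (n * Real.pi)) * (-1) ^ (n : ℕ)

/-- `(-1)^n π² cosh(nπ) / (n^p sinh²(nπ))`. -/
noncomputable def coshTerm (p : ℕ) (n : ℕ+) : ℂ :=
  Real.pi ^ 2 * Complex.cosh (n * Real.pi) / ((n : ℂ) ^ p * Complex.sinh (n * Real.pi) ^ 2)
    * (-1) ^ (n : ℕ)

/-- `(-1)^n π / (n^p sinh(nπ)) · i^(p+1) (ψ(ni) + (-1)^(p+1) ψ(-ni) + (1 + (-1)^(p+1)) γ)`,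
where `ψ` is the digamma function and `γ` the Euler-Mascheroni constant. -/
noncomputable def digammaTerm (p : ℕ) (n : ℕ+) : ℂ :=
  (-1) ^ (n : ℕ) * Real.pi / ((n : ℂ) ^ p * Complex.sinh (n * Real.pi)) * Complex.I ^ (p + 1)
    * (Complex.digamma (n * Complex.I) + (-1) ^ (p + 1) * Complex.digamma (-(n * Complex.I))
      + (1 + (-1) ^ (p + 1)) * Real.eulerMascheroniConstant)

/-- Pairs `(n₁, n₂)` of positive integers with `2 n₁ + n₂ = m`. -/
def pairsTwoOne (m : ℕ) : Finset (ℕ × ℕ) :=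
  (Finset.Icc 1 m ×ˢ Finset.Icc 1 m).filter fun q => 2 * q.1 + q.2 = m

/-- Pairs `(n₁, n₂)` of positive integers with `2 n₁ + 2 n₂ = m`. -/
def pairsTwoTwo (m : ℕ) : Finset (ℕ × ℕ) :=
  (Finset.Icc 1 m ×ˢ Finset.Icc 1 m).filter fun q => 2 * q.1 + 2 * q.2 = m

/-- Triples `(n₁, n₂, n₃)` of positive integers with `2 n₁ + 2 n₂ + n₃ = m`. -/
def triplesTwoTwoOne (m : ℕ) : Finset (ℕ × ℕ × ℕ) :=
  (Finset.Icc 1 m ×ˢ Finset.Icc 1 m ×ˢ Finset.Icc 1 m).filter fun q =>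
    2 * q.1 + 2 * q.2.1 + q.2.2 = m

open Filter Topology

/-! Write a_n = (-1)^n π / sinh(nπ), the residue at s = n of K(s) = π² / (sin(πs) sinh(πs)). The
kernel expands as K(s) = 1/s² + ∑ 2n a_n (1/(s² - n²) + 1/(s² + n²)), and comparing constant terms
at the pole s = k expresses π² cosh(kπ) / sinh²(kπ) through the a_n (`cothCoeff_eq`). No contour
integral is used: inserting the partial fractions of csch into a_n turns the claim into an
interchange in a double series (`tsum_altAddSum_div_sub`).

Dividing by k^p, summing over k and interchanging (`hasSum_cothCoeff`) writes the cosh series as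
ζ(p+2) - ½ ∑ a_n/n^(p+1) plus the sums of 2n a_n against `diffSum p n` and `addSum p n`. Both inner
sums satisfy a recurrence from p to p + 2, so they reduce to p = 0 and p = 1. The harmonic numbers
enter through `diffSum 1`, the values ψ(±ni) through `addSum 0` and `addSum 1`
(`two_mul_diffSum_eq`, `two_mul_addSum_eq`), and each step of the recurrence leaves a zeta value.

What remains are multiples of ∑ a_n/n^(2j+1) carrying a factor that vanishes for even j. For odd j,
symmetrising a double series in its two indices evaluates this sum by products of alternating zeta
values (`tsum_cschCoeff_div_pow`). These products give the finite sums of the theorem. -/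

lemma HasSum.congr_of_eq {ι E : Type*} [AddCommMonoid E] [TopologicalSpace E] {f g : ι → E}
    {a b : E} (h : HasSum f a) (hfg : ∀ i, g i = f i) (hab : b = a) : HasSum g b := by
  rwa [hab, funext hfg]

/-! ### Zeta and alternating zeta values as series over the positive integers -/

lemma summable_pnat_inv_sq : Summable fun n : ℕ+ => 1 / (n : ℝ) ^ 2 :=
  (Real.summable_one_div_nat_pow.mpr one_lt_two).comp_injective PNat.coe_injective

lemma summable_pnat_of_le_inv_sq {f : ℕ+ → ℂ} (C : ℝ) (h : ∀ n, ‖f n‖ ≤ C * (1 / (n : ℝ) ^ 2)) :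
    Summable f :=
  Summable.of_norm_bounded (summable_pnat_inv_sq.mul_left C) h

lemma norm_neg_one_pow (n : ℕ) : ‖(-1 : ℂ) ^ n‖ = 1 := by simp

lemma neg_one_pow_mul_self (n : ℕ) : (-1 : ℂ) ^ n * (-1) ^ n = 1 := by
  rw [← mul_pow]; simp

/-- Summing `(1 + (-1)^n) f n` amounts to summing `2 f` over the even integers. -/
lemma hasSum_one_add_neg_one_pow_mul {f : ℕ+ → ℂ} {S : ℂ}
    (h : HasSum (fun m : ℕ+ => 2 * f (2 * m)) S) :
    HasSum (fun n : ℕ+ => (1 + (-1 : ℂ) ^ (n : ℕ)) * f n) S := by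
  have hinj : Function.Injective fun m : ℕ+ => 2 * m := fun a b hab => by simpa using hab
  rw [← hinj.hasSum_iff]
  · refine h.congr_of_eq (fun m => ?_) rfl
    simp only [Function.comp_apply, PNat.mul_coe, PNat.val_ofNat, pow_mul]
    norm_num
  · intro n hn
    rcases Nat.even_or_odd (n : ℕ) with he | ho
    · obtain ⟨r, hr⟩ := he
      have hr0 : 0 < r := by have := n.pos; omega
      refine absurd ⟨⟨r, hr0⟩, PNat.coe_injective ?_⟩ hn
      change 2 * r = n
      omega
    · rw [ho.neg_one_pow]; simp

lemma hasSum_riemannZeta {k : ℕ} (hk : 2 ≤ k) :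
    HasSum (fun n : ℕ+ => 1 / (n : ℂ) ^ k) (riemannZeta k) := by
  have hs : Summable fun n : ℕ => 1 / (n : ℂ) ^ k := by
    rw [← summable_norm_iff]
    simpa using Real.summable_nat_pow_inv.mpr (show 1 < k by omega)
  have := hs.hasSum
  rw [← zeta_nat_eq_tsum_of_gt_one (by omega)] at this
  refine (PNat.coe_injective.hasSum_iff (f := fun n : ℕ => 1 / (n : ℂ) ^ k) ?_).mpr this
  intro n hn
  have : n = 0 := by
    by_contra h
    exact hn ⟨⟨n, Nat.pos_of_ne_zero h⟩, rfl⟩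
  subst this
  have : k ≠ 0 := by omega
  simp [this]

lemma summable_one_div_pnat_pow {k : ℕ} (hk : 2 ≤ k) : Summable fun n : ℕ+ => 1 / (n : ℂ) ^ k :=
  (hasSum_riemannZeta hk).summable

lemma summable_neg_one_pow_mul {f : ℕ+ → ℂ} (hf : Summable f) :
    Summable fun n : ℕ+ => (-1 : ℂ) ^ (n : ℕ) * f n := by
  rw [← summable_norm_iff] at hf ⊢
  simpa using hf

lemma hasSum_altZeta {k : ℕ} (hk : 2 ≤ k) :
    HasSum (fun n : ℕ+ => (-1 : ℂ) ^ (n : ℕ) * (1 / (n : ℂ) ^ k)) (-altZeta k) := by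
  have h := (summable_neg_one_pow_mul (summable_one_div_pnat_pow hk)).hasSum
  convert h using 1
  rw [altZeta, ← tsum_neg]
  congr 1; ext n
  obtain ⟨m, hm⟩ : ∃ m, (n : ℕ) = m + 1 := ⟨n - 1, by have := n.pos; omega⟩
  simp only [hm, Complex.cpow_natCast, pow_succ, Nat.add_sub_cancel]
  ring

/-- Adding the two series doubles the even terms and kills the odd ones, so ζ(k) minus its
alternating version is 2^(1-k) ζ(k). -/
lemma altZeta_eq_riemannZeta {k : ℕ} (hk : 2 ≤ k) :
    altZeta k = (1 - (2 : ℂ) ^ (1 - (k : ℤ))) * riemannZeta k := by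
  have h1 := hasSum_riemannZeta hk
  have h2 := h1.add (hasSum_altZeta hk)
  have h3 : HasSum (fun n : ℕ+ => (1 + (-1 : ℂ) ^ (n : ℕ)) * (1 / (n : ℂ) ^ k))
      ((2 : ℂ) ^ (1 - (k : ℤ)) * riemannZeta k) := by
    apply hasSum_one_add_neg_one_pow_mul
    refine (h1.mul_left ((2 : ℂ) ^ (1 - (k : ℤ)))).congr_of_eq (fun m => ?_) rfl
    rw [zpow_sub₀ two_ne_zero]
    simp only [PNat.mul_coe, PNat.val_ofNat, Nat.cast_mul, Nat.cast_ofNat, mul_pow, zpow_one,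
      zpow_natCast]
    field_simp
  have h4 : HasSum (fun n : ℕ+ => (1 + (-1 : ℂ) ^ (n : ℕ)) * (1 / (n : ℂ) ^ k))
      (riemannZeta k + -altZeta k) :=
    h2.congr_of_eq (fun n => by ring) rfl
  linear_combination h3.unique h4

/-! ### Partial fractions of csc, csch and the derivative of csch -/

open Complex in
/-- Partial fraction expansion of the cosecant. -/
lemma hasSum_csc {x : ℂ} (hx : ∀ n : ℤ, 2 * x ≠ n) (hs : Complex.sin (Real.pi * x) ≠ 0) :
    HasSum (fun n : ℕ+ => (-1 : ℂ) ^ (n : ℕ) * (2 * x / (x ^ 2 - n ^ 2)))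
      (Real.pi / Complex.sin (Real.pi * x) - 1 / x) := by
  have hmem : ∀ y : ℂ, (∀ n : ℤ, y ≠ n) → y ∈ Complex.integerComplement := by
    rintro y hy ⟨n, hn⟩
    exact hy n hn.symm
  have hcot : ∀ y : ℂ, (∀ n : ℤ, y ≠ n) →
      HasSum (fun n : ℕ+ => 1 / (y - n) + 1 / (y + n))
        (Real.pi * Complex.cot (Real.pi * y) - 1 / y) := by
    intro y hy
    have hsum : Summable fun n : ℕ+ => 1 / (y - n) + 1 / (y + n) := by
      have := summable_cotTerm (hmem y hy)
      rw [← Equiv.pnatEquivNat.summable_iff] at this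
      refine this.congr fun n => ?_
      simp only [Function.comp_apply, cotTerm, Equiv.pnatEquivNat_apply, PNat.natPred]
      have h : (((n : ℕ) - 1 : ℕ) : ℂ) + 1 = n := by
        have := n.pos
        push_cast [Nat.cast_sub (show 1 ≤ (n : ℕ) from this)]; ring
      simp only [h]
    have := hsum.hasSum
    rw [cot_series_rep (hmem y hy)]
    convert this using 1
    ring
  have hx1 : ∀ n : ℤ, x ≠ n := fun n h => hx (2 * n) (by rw [h]; push_cast; ring)
  have hx2 : ∀ n : ℤ, x / 2 ≠ n := fun n h => hx (4 * n) (by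
    push_cast; linear_combination 4 * h)
  have hodd := hcot x hx1
  have heven : HasSum (fun n : ℕ+ => (1 + (-1 : ℂ) ^ (n : ℕ)) * (1 / (x - n) + 1 / (x + n)))
      (Real.pi * Complex.cot (Real.pi * (x / 2)) - 1 / (x / 2)) := by
    apply hasSum_one_add_neg_one_pow_mul
    refine (hcot (x / 2) hx2).congr_of_eq (fun m => ?_) rfl
    have h1 : x / 2 - m = (x - (2 * m : ℕ+)) / 2 := by push_cast; ring
    have h2 : x / 2 + m = (x + (2 * m : ℕ+)) / 2 := by push_cast; ring
    rw [h1, h2]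
    simp only [one_div, inv_div]
    ring
  have hx0 : x ≠ 0 := by simpa using hx1 0
  -- This is cot(y) - cot(2y) = 1 / sin(2y) with y = πx/2; the weights (1 + (-1)^n) - 1 leave the
  -- alternating sign.
  refine (heven.sub hodd).congr_of_eq (fun n => ?_) ?_
  · have h1 : x - n ≠ 0 := sub_ne_zero.mpr (by simpa using hx1 n)
    have h2 : x + n ≠ 0 := by
      intro h
      exact hx1 (-n) (by push_cast; linear_combination h)
    rw [sq_sub_sq]
    field_simp
    ring
  · have hd : Real.pi * x = 2 * (Real.pi * (x / 2)) := by ring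
    set y := Real.pi * (x / 2) with hy
    have hs' := hs
    rw [hd, Complex.sin_two_mul] at hs'
    have hsy : Complex.sin y ≠ 0 := fun h => hs' (by simp [h])
    have hcy : Complex.cos y ≠ 0 := fun h => hs' (by simp [h])
    rw [Complex.cot_eq_cos_div_sin, Complex.cot_eq_cos_div_sin, hd, Complex.sin_two_mul,
      Complex.cos_two_mul]
    field_simp
    ring

/-- Partial fraction expansion of the hyperbolic cosecant. -/
lemma hasSum_csch {r : ℝ} (hr : 0 < r) :
    HasSum (fun m : ℕ+ => (-1 : ℝ) ^ (m : ℕ) * (2 * r / (r ^ 2 + m ^ 2)))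
      (Real.pi / Real.sinh (Real.pi * r) - 1 / r) := by
  have hsin : Complex.sin (Real.pi * (r * Complex.I)) =
      Complex.sinh ((Real.pi * r : ℝ) : ℂ) * Complex.I := by
    rw [← Complex.sin_mul_I]; push_cast; ring_nf
  have hsh : Real.sinh (Real.pi * r) ≠ 0 := (Real.sinh_pos_iff.mpr (by positivity)).ne'
  have hsh' : Complex.sinh ((Real.pi * r : ℝ) : ℂ) ≠ 0 := by
    rw [← Complex.ofReal_sinh]; exact_mod_cast hsh
  have h := hasSum_csc (x := r * Complex.I) (fun n hn => by
    have := congrArg Complex.im hn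
    simp at this
    exact hr.ne' this) (by rw [hsin]; exact mul_ne_zero hsh' Complex.I_ne_zero)
  rw [← Complex.hasSum_ofReal]
  rw [hsin] at h
  refine (h.mul_left Complex.I).congr_of_eq (fun m => ?_) ?_
  · push_cast
    have h1 : ((r : ℂ) * Complex.I) ^ 2 - (m : ℂ) ^ 2 = -((r : ℂ) ^ 2 + (m : ℂ) ^ 2) := by
      rw [mul_pow, Complex.I_sq]; ring
    rw [h1, div_neg]
    linear_combination (-1 : ℂ) ^ (m : ℕ) * (2 * r / ((r : ℂ) ^ 2 + (m : ℂ) ^ 2)) * Complex.I_sq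
  · have hr' : (r : ℂ) ≠ 0 := by exact_mod_cast hr.ne'
    push_cast
    push_cast at hsh'
    field_simp [Complex.I_ne_zero]

/-- Termwise differentiation of `hasSum_csch`, justified by the bound 2/m² on the differentiated
terms, uniform over the half-line. -/
lemma hasSum_csch_deriv {r : ℝ} (hr : 0 < r) :
    HasSum (fun m : ℕ+ => (-1 : ℝ) ^ (m : ℕ) * (2 * (m ^ 2 - r ^ 2) / (r ^ 2 + m ^ 2) ^ 2))
      (1 / r ^ 2 - Real.pi ^ 2 * Real.cosh (Real.pi * r) / Real.sinh (Real.pi * r) ^ 2) := by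
  have hb : ∀ (m : ℕ+) (s : ℝ), s ∈ Set.Ioi (0 : ℝ) →
      ‖(-1 : ℝ) ^ (m : ℕ) * (2 * (m ^ 2 - s ^ 2) / (s ^ 2 + m ^ 2) ^ 2)‖
        ≤ 2 * (1 / (m : ℝ) ^ 2) := by
    intro m s hs
    have hm : (0 : ℝ) < m := by exact_mod_cast m.pos
    rw [norm_mul, norm_pow, norm_neg, norm_one, one_pow, one_mul, Real.norm_eq_abs, abs_div,
      abs_mul, abs_two, abs_of_pos (show (0 : ℝ) < (s ^ 2 + m ^ 2) ^ 2 by positivity), mul_div_assoc]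
    refine mul_le_mul_of_nonneg_left ?_ zero_le_two
    rw [div_le_div_iff₀ (by positivity) (by positivity), one_mul]
    have : |(m : ℝ) ^ 2 - s ^ 2| ≤ s ^ 2 + m ^ 2 := by
      rw [abs_le]; constructor <;> nlinarith [sq_nonneg s, sq_nonneg (m : ℝ)]
    calc |(m : ℝ) ^ 2 - s ^ 2| * m ^ 2 ≤ (s ^ 2 + m ^ 2) * (s ^ 2 + m ^ 2) := by
          gcongr
          nlinarith [sq_nonneg s]
      _ = (s ^ 2 + m ^ 2) ^ 2 := by ring
  have hd := hasDerivAt_tsum_of_isPreconnected (𝕜 := ℝ)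
    (g := fun (m : ℕ+) (s : ℝ) => (-1 : ℝ) ^ (m : ℕ) * (2 * s / (s ^ 2 + m ^ 2)))
    (g' := fun (m : ℕ+) (s : ℝ) => (-1 : ℝ) ^ (m : ℕ) * (2 * (m ^ 2 - s ^ 2) / (s ^ 2 + m ^ 2) ^ 2))
    (summable_pnat_inv_sq.mul_left 2) isOpen_Ioi isPreconnected_Ioi ?_ hb
    (Set.mem_Ioi.mpr hr) (hasSum_csch hr).summable (Set.mem_Ioi.mpr hr)
  · have hsum : Summable fun m : ℕ+ =>
        (-1 : ℝ) ^ (m : ℕ) * (2 * (m ^ 2 - r ^ 2) / (r ^ 2 + m ^ 2) ^ 2) :=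
      Summable.of_norm_bounded (summable_pnat_inv_sq.mul_left 2) fun m => hb m r hr
    have hsh : Real.sinh (Real.pi * r) ≠ 0 := (Real.sinh_pos_iff.mpr (by positivity)).ne'
    have hd2 : HasDerivAt (fun s : ℝ => Real.pi / Real.sinh (Real.pi * s) - 1 / s)
        (1 / r ^ 2 - Real.pi ^ 2 * Real.cosh (Real.pi * r) / Real.sinh (Real.pi * r) ^ 2) r := by
      have h1 : HasDerivAt (fun s : ℝ => Real.sinh (Real.pi * s))
          (Real.cosh (Real.pi * r) * Real.pi) r := by
        have := (Real.hasDerivAt_sinh (Real.pi * r)).comp r ((hasDerivAt_id r).const_mul Real.pi)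
        simpa [Function.comp_def] using this
      have h2 := ((hasDerivAt_const r Real.pi).div h1 hsh).sub
        ((hasDerivAt_const r (1 : ℝ)).div (hasDerivAt_id r) hr.ne')
      refine h2.congr_deriv ?_
      simp only [id]
      have := hr.ne'
      field_simp
      ring
    have heq : (fun s : ℝ => ∑' m : ℕ+, (-1 : ℝ) ^ (m : ℕ) * (2 * s / (s ^ 2 + m ^ 2)))
        =ᶠ[𝓝 r] fun s : ℝ => Real.pi / Real.sinh (Real.pi * s) - 1 / s := by
      filter_upwards [eventually_gt_nhds hr] with s hs using (hasSum_csch hs).tsum_eq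
    have := (hd.congr_of_eventuallyEq heq.symm).unique hd2
    rw [← this]
    exact hsum.hasSum
  · intro m s hs
    have hm : (0 : ℝ) < m := by exact_mod_cast m.pos
    have hne : s ^ 2 + (m : ℝ) ^ 2 ≠ 0 := by positivity
    have h := (((hasDerivAt_id s).const_mul 2).div
      (((hasDerivAt_id s).pow 2).add_const ((m : ℝ) ^ 2)) hne).const_mul ((-1 : ℝ) ^ (m : ℕ))
    refine h.congr_deriv ?_
    simp only [id, Pi.pow_apply]
    norm_num
    congr 1
    ring

/-! ### Telescoping series with denominators k² - n² -/

lemma tendsto_sum_range_sub_shift {ψ : ℕ → ℂ} (hψ : Tendsto ψ atTop (𝓝 0)) (d : ℕ) :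
    Tendsto (fun N => ∑ k ∈ Finset.range N, (ψ k - ψ (k + d))) atTop
      (𝓝 (∑ k ∈ Finset.range d, ψ k)) := by
  have h : ∀ N, ∑ k ∈ Finset.range N, (ψ k - ψ (k + d)) =
      ∑ k ∈ Finset.range d, ψ k - ∑ k ∈ Finset.range d, ψ (k + N) := by
    intro N
    induction N with
    | zero => simp
    | succ N ih =>
      have h1 := Finset.sum_range_succ (fun k => ψ (k + N)) d
      have h2 := Finset.sum_range_succ' (fun k => ψ (k + N)) d
      rw [Finset.sum_range_succ, ih]
      have h3 : ∀ k, ψ (k + (N + 1)) = ψ (k + 1 + N) := fun k => by congr 1; omega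
      simp only [h3]
      rw [zero_add] at h2
      rw [add_comm N d]
      linear_combination h1 - h2
  simp only [h]
  have h0 : Tendsto (fun N => ∑ k ∈ Finset.range d, ψ (k + N)) atTop (𝓝 0) := by
    have : Tendsto (fun N => ∑ k ∈ Finset.range d, ψ (k + N)) atTop
        (𝓝 (∑ k ∈ Finset.range d, (0 : ℂ))) := by
      refine tendsto_finsetSum _ fun k _ => hψ.comp ?_
      exact tendsto_atTop_mono (fun N => Nat.le_add_left N k) tendsto_id
    simpa using this
  simpa using h0.const_sub (∑ k ∈ Finset.range d, ψ k)

lemma hasSum_pnat_of_tendsto {f : ℕ → ℂ} {S : ℂ} (hf : Summable fun n : ℕ+ => f n)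
    (h : Tendsto (fun N => ∑ k ∈ Finset.range N, f (k + 1)) atTop (𝓝 S)) :
    HasSum (fun n : ℕ+ => f n) S := by
  have h1 : ∀ n : ℕ+, (n : ℕ) = Equiv.pnatEquivNat n + 1 := fun n => by
    simp [Equiv.pnatEquivNat_apply]
  have h2 : (fun n : ℕ+ => f n) = (fun k : ℕ => f (k + 1)) ∘ Equiv.pnatEquivNat := by
    ext n
    rw [Function.comp_apply, ← h1]
  rw [h2] at hf ⊢
  rw [Equiv.summable_iff] at hf
  rw [Equiv.hasSum_iff]
  exact (hf.hasSum_iff_tendsto_nat).mpr h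

/-- A telescoping sum attached to an odd function on the integers tending to zero. -/
lemma tendsto_sum_odd_telescope {φ : ℤ → ℂ} (hodd : ∀ j, φ (-j) = -φ j)
    (hφ : Tendsto (fun n : ℕ => φ n) atTop (𝓝 0)) (k : ℕ) :
    Tendsto (fun N => ∑ j ∈ Finset.range N, (φ ((j + 1 : ℕ) - k) - φ ((j + 1 : ℕ) + k))) atTop
      (𝓝 (φ k)) := by
  have h0 : φ 0 = 0 := by
    have := hodd 0
    rw [neg_zero] at this
    linear_combination this / 2
  have hψ : Tendsto (fun n : ℕ => φ ((n + 1 : ℕ) - k)) atTop (𝓝 0) := by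
    rw [← tendsto_add_atTop_iff_nat k]
    refine (hφ.comp (tendsto_add_atTop_nat 1)).congr fun n => ?_
    simp only [Function.comp_apply]
    congr 1
    push_cast
    ring
  have h := tendsto_sum_range_sub_shift hψ (2 * k)
  -- The window of arguments runs from 1 - k to k; by oddness everything cancels except the value at
  -- k.
  have hsum : ∀ k : ℕ, ∑ j ∈ Finset.range (2 * k), φ ((j + 1 : ℕ) - k) = φ k := by
    intro k
    induction k with
    | zero => simp [h0]
    | succ k ih =>
      rw [show 2 * (k + 1) = 2 * k + 1 + 1 by ring, Finset.sum_range_succ, Finset.sum_range_succ']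
      have h3 : ∀ j : ℕ, φ (((j + 1 + 1 : ℕ) : ℤ) - ((k + 1 : ℕ) : ℤ)) = φ ((j + 1 : ℕ) - k) :=
        fun j => by congr 1; push_cast; ring
      simp only [h3]
      rw [ih, show (((0 + 1 : ℕ) : ℤ) - ((k + 1 : ℕ) : ℤ)) = -k by push_cast; ring, hodd,
        show (((2 * k + 1 : ℕ) : ℤ) - (k : ℤ)) = (k + 1 : ℕ) by push_cast; ring]
      ring
  rw [hsum k] at h
  refine h.congr fun N => Finset.sum_congr rfl fun j _ => ?_
  congr 2
  push_cast
  ring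

lemma tendsto_one_div_natCast_complex : Tendsto (fun n : ℕ => 1 / (n : ℂ)) atTop (𝓝 0) :=
  tendsto_const_div_atTop_nhds_zero_nat 1

/-- For k ≠ n the integer k² - n² has absolute value at least 1, hence k² ≤ |k² - n²| + n² ≤ (1 +
n²)|k² - n²|. For k = n the left side is 0 by the division convention. -/
lemma norm_one_div_sq_sub_sq_le (n k : ℕ+) :
    ‖1 / ((k : ℂ) ^ 2 - (n : ℂ) ^ 2)‖ ≤ (1 + (n : ℝ) ^ 2) * (1 / (k : ℝ) ^ 2) := by
  rcases eq_or_ne k n with rfl | hkn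
  · simp; positivity
  have hk : (0 : ℝ) < k := by exact_mod_cast k.pos
  have hz : (1 : ℝ) ≤ |(k : ℝ) ^ 2 - (n : ℝ) ^ 2| := by
    have : ((k : ℕ) : ℤ) ^ 2 - ((n : ℕ) : ℤ) ^ 2 ≠ 0 := by
      intro h
      apply hkn
      apply PNat.coe_injective
      have h1 : ((k : ℕ) : ℤ) ^ 2 = ((n : ℕ) : ℤ) ^ 2 := by linarith
      exact_mod_cast (pow_left_inj₀ (by positivity) (by positivity) two_ne_zero).mp h1
    exact_mod_cast Int.one_le_abs this
  have hn : ‖(k : ℂ) ^ 2 - (n : ℂ) ^ 2‖ = |(k : ℝ) ^ 2 - (n : ℝ) ^ 2| := by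
    rw [← Real.norm_eq_abs, ← Complex.norm_real]; push_cast; rfl
  rw [norm_div, norm_one, hn, mul_one_div, div_le_div_iff₀ (by linarith) (by positivity), one_mul]
  have h1 : (k : ℝ) ^ 2 ≤ |(k : ℝ) ^ 2 - (n : ℝ) ^ 2| + (n : ℝ) ^ 2 := by
    linarith [le_abs_self ((k : ℝ) ^ 2 - (n : ℝ) ^ 2)]
  nlinarith [sq_nonneg (n : ℝ)]

lemma norm_one_div_sq_add_sq_le (n k : ℕ+) :
    ‖1 / ((k : ℂ) ^ 2 + (n : ℂ) ^ 2)‖ ≤ 1 * (1 / (k : ℝ) ^ 2) := by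
  have hk : (0 : ℝ) < k := by exact_mod_cast k.pos
  have hn : ‖(k : ℂ) ^ 2 + (n : ℂ) ^ 2‖ = (k : ℝ) ^ 2 + (n : ℝ) ^ 2 := by
    rw [← abs_of_nonneg (show (0 : ℝ) ≤ (k : ℝ) ^ 2 + (n : ℝ) ^ 2 by positivity),
      ← Real.norm_eq_abs, ← Complex.norm_real]
    push_cast; rfl
  rw [norm_div, norm_one, hn, one_mul]
  gcongr
  nlinarith [sq_nonneg (n : ℝ)]

lemma pnat_sq_add_sq_ne_zero (k n : ℕ+) : (k : ℂ) ^ 2 + (n : ℂ) ^ 2 ≠ 0 := by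
  have : 0 < (k : ℕ) ^ 2 + (n : ℕ) ^ 2 := by have := k.pos; positivity
  exact_mod_cast this.ne'

lemma pnat_sq_sub_sq_ne_zero {k n : ℕ+} (h : k ≠ n) : (k : ℂ) ^ 2 - (n : ℂ) ^ 2 ≠ 0 := by
  have hz : ((k : ℕ) : ℂ) - (n : ℕ) ≠ 0 :=
    sub_ne_zero.mpr (by exact_mod_cast fun h' => h (PNat.coe_injective h'))
  have hz2 : (k : ℂ) + (n : ℂ) ≠ 0 := by
    have : 0 < (k : ℕ) + (n : ℕ) := by have := k.pos; omega
    exact_mod_cast this.ne'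
  rw [sq_sub_sq]
  exact mul_ne_zero hz2 hz

lemma pnat_sub_ne_zero {k n : ℕ+} (h : k ≠ n) : (k : ℂ) - (n : ℂ) ≠ 0 :=
  sub_ne_zero.mpr (by exact_mod_cast fun h' => h (PNat.coe_injective h'))

lemma pnat_add_ne_zero (k n : ℕ+) : (k : ℂ) + (n : ℂ) ≠ 0 := by
  have : 0 < (k : ℕ) + (n : ℕ) := by have := k.pos; omega
  exact_mod_cast this.ne'

/-- The term `n = k` contributes zero here, as division by zero yields zero. -/
lemma hasSum_sign_pow_div_sq_sub_sq {ε : ℂ} (hε : ε * ε = 1) (k : ℕ+) :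
    HasSum (fun n : ℕ+ => ε ^ (n : ℕ) * (1 / ((k : ℂ) ^ 2 - (n : ℂ) ^ 2)))
      (-1 / (2 * (k : ℂ) ^ 2) - ε ^ (k : ℕ) / (4 * (k : ℂ) ^ 2)) := by
  have hk : (k : ℂ) ≠ 0 := by exact_mod_cast k.ne_zero
  have hε0 : ε ≠ 0 := left_ne_zero_of_mul_eq_one hε
  have hεn : ‖ε‖ = 1 := by
    have := congrArg norm hε
    rw [norm_mul, norm_one] at this
    nlinarith [norm_nonneg ε]
  have hεinv : ε⁻¹ = ε := inv_eq_of_mul_eq_one_left hε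
  let φ : ℤ → ℂ := fun j => ε ^ j * (1 / (j : ℂ))
  have hodd : ∀ j, φ (-j) = -φ j := fun j => by
    simp only [φ, zpow_neg, ← inv_zpow, hεinv, Int.cast_neg, one_div, inv_neg, mul_neg]
  have hφ : Tendsto (fun n : ℕ => φ n) atTop (𝓝 0) := by
    rw [tendsto_zero_iff_norm_tendsto_zero]
    refine (tendsto_zero_iff_norm_tendsto_zero.mp tendsto_one_div_natCast_complex).congr fun n => ?_
    simp [φ, hεn]
  have hs : ε ^ (k : ℕ) * ε ^ (k : ℕ) = 1 := by rw [← mul_pow, hε, one_pow]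
  have hsub : Summable fun n : ℕ+ => ε ^ (n : ℕ) * (1 / ((k : ℂ) ^ 2 - (n : ℂ) ^ 2)) := by
    refine summable_pnat_of_le_inv_sq (1 + (k : ℝ) ^ 2) fun n => ?_
    have := norm_one_div_sq_sub_sq_le k n
    rw [norm_mul, norm_pow, hεn, one_pow, one_mul]
    rwa [norm_div, norm_sub_rev, ← norm_div] at this
  -- Since ε⁻¹ = ε, both fractions carry the sign ε^(n+k). At n = k the convention gives φ 0 = 0,
  -- and only -φ(2k) = -1/(2k) survives; the indicator accounts for it.
  have hterm : ∀ n : ℕ+, φ ((n : ℕ) - (k : ℕ)) - φ ((n : ℕ) + (k : ℕ)) =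
      -(2 * k * ε ^ (k : ℕ)) * (ε ^ (n : ℕ) * (1 / ((k : ℂ) ^ 2 - (n : ℂ) ^ 2)))
        - if n = k then 1 / (2 * (k : ℂ)) else 0 := by
    intro n
    have e1 : ε ^ (((n : ℕ) : ℤ) - ((k : ℕ) : ℤ)) = ε ^ (n : ℕ) * ε ^ (k : ℕ) := by
      rw [zpow_sub₀ hε0, zpow_natCast, zpow_natCast, div_eq_mul_inv, ← inv_pow, hεinv]
    have e2 : ε ^ (((n : ℕ) : ℤ) + ((k : ℕ) : ℤ)) = ε ^ (n : ℕ) * ε ^ (k : ℕ) := by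
      rw [zpow_add₀ hε0, zpow_natCast, zpow_natCast]
    simp only [φ, e1, e2]
    push_cast
    split_ifs with h
    · subst h
      simp only [sub_self, div_zero, mul_zero, zero_sub, hs, one_mul]
      ring
    · have h1 := pnat_sub_ne_zero h
      have h2 := pnat_add_ne_zero n k
      have h3 := pnat_sub_ne_zero (Ne.symm h)
      rw [sq_sub_sq, add_comm (k : ℂ), ← neg_sub (n : ℂ)]
      field_simp
      ring
  have hsing : HasSum (fun n : ℕ+ => if n = k then 1 / (2 * (k : ℂ)) else 0) (1 / (2 * (k : ℂ))) :=
    hasSum_ite_eq k _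
  have hG : HasSum (fun n : ℕ+ => φ ((n : ℕ) - (k : ℕ)) - φ ((n : ℕ) + (k : ℕ))) (φ k) := by
    refine hasSum_pnat_of_tendsto (f := fun n : ℕ => φ (n - (k : ℕ)) - φ (n + (k : ℕ))) ?_
      (tendsto_sum_odd_telescope hodd hφ k)
    exact ((hsub.mul_left (-(2 * k * ε ^ (k : ℕ)))).sub hsing.summable).congr
      fun n => (hterm n).symm
  refine ((hG.add hsing).mul_left (-(ε ^ (k : ℕ)) / (2 * k))).congr_of_eq (fun n => ?_) ?_
  · rw [hterm]
    generalize ε ^ (n : ℕ) * (1 / ((k : ℂ) ^ 2 - (n : ℂ) ^ 2)) = X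
    field_simp
    linear_combination (-2 * X * k) * hs
  · simp only [φ, zpow_natCast, Int.cast_natCast]
    field_simp
    linear_combination 8 * hs

lemma hasSum_one_div_sub_one_div_add (n : ℕ+) :
    HasSum (fun k : ℕ+ => 1 / (k : ℂ) - 1 / ((k : ℂ) + n)) (harmonic (n : ℕ) : ℂ) := by
  have hs : Summable fun k : ℕ+ => 1 / (k : ℂ) - 1 / ((k : ℂ) + n) := by
    refine summable_pnat_of_le_inv_sq n fun k => ?_
    have hk : (0 : ℝ) < k := by exact_mod_cast k.pos
    have hn : (0 : ℝ) < n := by exact_mod_cast n.pos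
    have h1 : 1 / (k : ℂ) - 1 / ((k : ℂ) + n) = ((n / (k * (k + n)) : ℝ) : ℂ) := by
      have := pnat_add_ne_zero k n
      have hk' : (k : ℂ) ≠ 0 := by exact_mod_cast k.ne_zero
      push_cast
      field_simp
      ring
    rw [h1, Complex.norm_real, Real.norm_of_nonneg (by positivity), mul_one_div]
    gcongr
    nlinarith
  have hψ : Tendsto (fun k : ℕ => 1 / ((k + 1 : ℕ) : ℂ)) atTop (𝓝 0) :=
    tendsto_one_div_natCast_complex.comp (tendsto_add_atTop_nat 1)
  have h := tendsto_sum_range_sub_shift hψ n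
  refine (hasSum_pnat_of_tendsto (f := fun k : ℕ => 1 / (k : ℂ) - 1 / ((k : ℂ) + n)) hs
    (h.congr fun N => Finset.sum_congr rfl fun j _ => ?_)).congr_of_eq (fun k => rfl) ?_
  · push_cast
    ring
  · rw [harmonic]
    push_cast
    exact Finset.sum_congr rfl fun j _ => by rw [one_div]

/-- Partial fractions: 2n²/(k(k² - n²)) = 1/(k-n) + 1/(k+n) - 2/k, regrouped as (1/(k-n) - 1/(k+n))
- 2(1/k - 1/(k+n)) so that both pieces converge. The indicator restores the value 0 at k = n. -/
lemma hasSum_one_div_mul_sq_sub_sq (n : ℕ+) :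
    HasSum (fun k : ℕ+ => 1 / ((k : ℂ) * ((k : ℂ) ^ 2 - (n : ℂ) ^ 2)))
      ((-2 * (harmonic (n : ℕ) : ℂ) + 5 / (2 * n)) / (2 * (n : ℂ) ^ 2)) := by
  have hn : (n : ℂ) ≠ 0 := by exact_mod_cast n.ne_zero
  have h1 := hasSum_sign_pow_div_sq_sub_sq (ε := 1) (by norm_num) n
  have h2 := hasSum_one_div_sub_one_div_add n
  have h3 : HasSum (fun k : ℕ+ => if k = n then 1 / (n : ℂ) else 0) (1 / (n : ℂ)) :=
    hasSum_ite_eq n _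
  refine ((((h1.mul_left (-2 * (n : ℂ))).sub (h2.mul_left 2)).add h3).mul_left
    (1 / (2 * (n : ℂ) ^ 2))).congr_of_eq (fun k => ?_) ?_
  · have hk : (k : ℂ) ≠ 0 := by exact_mod_cast k.ne_zero
    split_ifs with h
    · subst h
      simp only [sub_self, mul_zero, div_zero, zero_sub]
      field_simp
      ring
    · have e1 := pnat_sub_ne_zero h
      have e2 := pnat_add_ne_zero k n
      have e3 := pnat_sub_ne_zero (Ne.symm h)
      rw [one_pow, sq_sub_sq, sq_sub_sq, add_comm (n : ℂ), ← neg_sub (k : ℂ)]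
      field_simp
      ring
  · rw [one_pow]
    field_simp
    ring

/-! ### Sums over k of 1 / (k^p (k² ± n²)) and their recurrences in p -/

/-- `∑_{k ≠ n} 1 / (k^p (k² - n²))`, the term `k = n` being zero by convention. -/
noncomputable def diffSum (p : ℕ) (n : ℕ+) : ℂ :=
  ∑' k : ℕ+, 1 / ((k : ℂ) ^ p * ((k : ℂ) ^ 2 - (n : ℂ) ^ 2))

/-- `∑_k 1 / (k^p (k² + n²))`. -/
noncomputable def addSum (p : ℕ) (n : ℕ+) : ℂ :=
  ∑' k : ℕ+, 1 / ((k : ℂ) ^ p * ((k : ℂ) ^ 2 + (n : ℂ) ^ 2))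

lemma norm_one_div_pow_mul_le (p : ℕ) (k : ℕ+) (z : ℂ) :
    ‖1 / ((k : ℂ) ^ p * z)‖ ≤ ‖1 / z‖ := by
  have hk : (1 : ℝ) ≤ (k : ℝ) ^ p := one_le_pow₀ (by exact_mod_cast one_le)
  rw [← one_div_mul_one_div, norm_mul]
  refine mul_le_of_le_one_left (norm_nonneg _) ?_
  rw [norm_div, norm_one, norm_pow, Complex.norm_natCast]
  exact (div_le_one (by linarith)).mpr hk

lemma norm_diffSum_term_le (p : ℕ) (n k : ℕ+) :
    ‖1 / ((k : ℂ) ^ p * ((k : ℂ) ^ 2 - (n : ℂ) ^ 2))‖ ≤ (1 + (n : ℝ) ^ 2) * (1 / (k : ℝ) ^ 2) :=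
  (norm_one_div_pow_mul_le p k _).trans (norm_one_div_sq_sub_sq_le n k)

lemma norm_addSum_term_le (p : ℕ) (n k : ℕ+) :
    ‖1 / ((k : ℂ) ^ p * ((k : ℂ) ^ 2 + (n : ℂ) ^ 2))‖ ≤ 1 * (1 / (k : ℝ) ^ 2) :=
  (norm_one_div_pow_mul_le p k _).trans (norm_one_div_sq_add_sq_le n k)

lemma hasSum_diffSum (p : ℕ) (n : ℕ+) :
    HasSum (fun k : ℕ+ => 1 / ((k : ℂ) ^ p * ((k : ℂ) ^ 2 - (n : ℂ) ^ 2))) (diffSum p n) :=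
  (summable_pnat_of_le_inv_sq _ (norm_diffSum_term_le p n)).hasSum

lemma hasSum_addSum (p : ℕ) (n : ℕ+) :
    HasSum (fun k : ℕ+ => 1 / ((k : ℂ) ^ p * ((k : ℂ) ^ 2 + (n : ℂ) ^ 2))) (addSum p n) :=
  (summable_pnat_of_le_inv_sq _ (norm_addSum_term_le p n)).hasSum

lemma diffSum_zero (n : ℕ+) : diffSum 0 n = 3 / (4 * (n : ℂ) ^ 2) := by
  have h := ((hasSum_sign_pow_div_sq_sub_sq (ε := 1) (by norm_num) n).mul_left (-1)).congr_of_eq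
    (g := fun k : ℕ+ => 1 / ((k : ℂ) ^ 0 * ((k : ℂ) ^ 2 - (n : ℂ) ^ 2))) (fun k => by
      rw [← neg_sub ((k : ℂ) ^ 2)]
      simp only [one_pow, pow_zero, one_mul, div_neg]
      ring) rfl
  rw [(hasSum_diffSum 0 n).unique h]
  have hn : (n : ℂ) ≠ 0 := by exact_mod_cast n.ne_zero
  rw [one_pow]
  field_simp
  norm_num

lemma diffSum_one (n : ℕ+) :
    diffSum 1 n = (-2 * (harmonic (n : ℕ) : ℂ) + 5 / (2 * n)) / (2 * (n : ℂ) ^ 2) :=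
  (hasSum_diffSum 1 n).unique
    ((hasSum_one_div_mul_sq_sub_sq n).congr_of_eq (fun k => by rw [pow_one]) rfl)

/-- From n²/(k^(p+2)(k² - n²)) = 1/(k^p(k² - n²)) - 1/k^(p+2) for k ≠ n; the full zeta value also
counts k = n, which the term 1/n^(p+2) puts back. -/
lemma diffSum_add_two (p : ℕ) (n : ℕ+) :
    diffSum (p + 2) n =
      (diffSum p n - riemannZeta (p + 2 : ℕ) + 1 / (n : ℂ) ^ (p + 2)) / (n : ℂ) ^ 2 := by
  have hn : (n : ℂ) ≠ 0 := by exact_mod_cast n.ne_zero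
  have h3 : HasSum (fun k : ℕ+ => if k = n then 1 / (n : ℂ) ^ (p + 2) else 0)
      (1 / (n : ℂ) ^ (p + 2)) := hasSum_ite_eq n _
  refine (hasSum_diffSum (p + 2) n).unique
    (((((hasSum_diffSum p n).sub (hasSum_riemannZeta (by omega : 2 ≤ p + 2))).add h3).div_const
      ((n : ℂ) ^ 2)).congr_of_eq (fun k => ?_) rfl)
  have hk : (k : ℂ) ≠ 0 := by exact_mod_cast k.ne_zero
  split_ifs with h
  · subst h
    simp
  · have := pnat_sq_sub_sq_ne_zero h
    rw [pow_add]
    field_simp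
    ring

lemma addSum_add_two (p : ℕ) (n : ℕ+) :
    addSum (p + 2) n = (riemannZeta (p + 2 : ℕ) - addSum p n) / (n : ℂ) ^ 2 := by
  have hn : (n : ℂ) ≠ 0 := by exact_mod_cast n.ne_zero
  refine (hasSum_addSum (p + 2) n).unique
    ((((hasSum_riemannZeta (by omega : 2 ≤ p + 2)).sub (hasSum_addSum p n)).div_const
      ((n : ℂ) ^ 2)).congr_of_eq (fun k => ?_) rfl)
  have hk : (k : ℂ) ≠ 0 := by exact_mod_cast k.ne_zero
  have := pnat_sq_add_sq_ne_zero k n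
  rw [pow_add]
  field_simp
  ring

lemma sum_zeta_div_pow_add_two (c : ℂ) (p : ℕ) (n : ℕ+) :
    ∑ j ∈ Finset.range ((p + 2) / 2), c ^ j * riemannZeta ((p + 2 - 2 * j : ℕ) : ℂ)
        / (n : ℂ) ^ (2 * j + 1) =
      c / (n : ℂ) ^ 2 * ∑ j ∈ Finset.range (p / 2), c ^ j * riemannZeta ((p - 2 * j : ℕ) : ℂ)
        / (n : ℂ) ^ (2 * j + 1) + riemannZeta (p + 2 : ℕ) / n := by
  have hn : (n : ℂ) ≠ 0 := by exact_mod_cast n.ne_zero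
  rw [show (p + 2) / 2 = p / 2 + 1 by omega, Finset.sum_range_succ', Finset.mul_sum]
  congr 1
  · refine Finset.sum_congr rfl fun j _ => ?_
    rw [show p + 2 - 2 * (j + 1) = p - 2 * j by omega]
    field_simp
    ring
  · simp

/-- Solves the recurrence `diffSum_add_two` from its values at p = 0 and p = 1. The extra 1/2 is
arranged to cancel the term -`cschCoeff k` / (2k) of `cothCoeff_eq` in the final count. -/
lemma two_mul_diffSum_eq (p : ℕ) (n : ℕ+) :
    2 * n * diffSum p n + (1 + (-1) ^ (p + 1)) * (harmonic (n : ℕ) : ℂ) / (n : ℂ) ^ p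
      - (p + (-1) ^ (p + 1) + 1 / 2) / (n : ℂ) ^ (p + 1) =
    -2 * ∑ j ∈ Finset.range (p / 2), 1 ^ j * riemannZeta ((p - 2 * j : ℕ) : ℂ)
        / (n : ℂ) ^ (2 * j + 1) + (1 + (-1) ^ p) / (n : ℂ) ^ (p + 1) := by
  have hn : (n : ℂ) ≠ 0 := by exact_mod_cast n.ne_zero
  induction p using Nat.twoStepInduction with
  | zero =>
    rw [diffSum_zero]
    simp
    field_simp
    ring
  | one =>
    rw [diffSum_one]
    simp
    field_simp
    ring
  | more p ih _ =>
    have h1 : (-1 : ℂ) ^ (p + 2 + 1) = (-1) ^ (p + 1) := by ring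
    have h2 : (-1 : ℂ) ^ (p + 2) = (-1) ^ p := by ring
    rw [sum_zeta_div_pow_add_two, diffSum_add_two, h1, h2]
    push_cast
    generalize ∑ j ∈ Finset.range (p / 2), 1 ^ j * riemannZeta ((p - 2 * j : ℕ) : ℂ)
        / (n : ℂ) ^ (2 * j + 1) = S at *
    generalize diffSum p n = X at *
    have hQ : (n : ℂ) ^ p ≠ 0 := pow_ne_zero _ hn
    simp only [pow_add, pow_one] at ih ⊢
    generalize (n : ℂ) ^ p = Q at *
    generalize (-1 : ℂ) ^ p = s at *
    field_simp at ih ⊢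
    linear_combination ih

/-! ### The digamma series -/

/-- The logarithmic derivative of the real Gamma function satisfies the digamma recurrence. -/
lemma deriv_log_Gamma_add_natCast {x : ℝ} (hx : 0 < x) (n : ℕ) :
    deriv (Real.log ∘ Real.Gamma) (x + n) =
      deriv (Real.log ∘ Real.Gamma) x + ∑ k ∈ Finset.range n, 1 / (x + k) := by
  have hd : ∀ y : ℝ, 0 < y → DifferentiableAt ℝ (Real.log ∘ Real.Gamma) y := fun y hy =>
    (Real.differentiableAt_Gamma fun m => ne_of_gt (by linarith [m.cast_nonneg (α := ℝ)])).log
      (Real.Gamma_pos_of_pos hy).ne'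
  induction n with
  | zero => simp
  | succ n ih =>
    have hxn : 0 < x + n := by positivity
    have hrec : deriv (Real.log ∘ Real.Gamma) (x + n + 1) =
        deriv (Real.log ∘ Real.Gamma) (x + n) + 1 / (x + n) := by
      rw [← deriv_comp_add_const, one_div, ← Real.deriv_log,
        ← deriv_add (hd _ hxn) (Real.differentiableAt_log hxn.ne')]
      apply EventuallyEq.deriv_eq
      filter_upwards [eventually_gt_nhds hxn] with y hy
      simp only [Function.comp_apply, Pi.add_apply]
      rw [Real.Gamma_add_one hy.ne', Real.log_mul hy.ne' (Real.Gamma_pos_of_pos hy).ne', add_comm]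
    rw [Finset.sum_range_succ, Nat.cast_succ, ← add_assoc, hrec, ih, add_assoc]

lemma deriv_log_Gamma_natCast_add_one (n : ℕ) :
    deriv (Real.log ∘ Real.Gamma) (n + 1) = -Real.eulerMascheroniConstant + harmonic n := by
  have hn : (0 : ℝ) < n + 1 := by positivity
  have h : deriv (Real.log ∘ Real.Gamma) (n + 1) =
      deriv Real.Gamma (n + 1) / Real.Gamma (n + 1) := by
    rw [Function.comp_def, deriv.log (Real.differentiableAt_Gamma fun m => ne_of_gt
      (by linarith [m.cast_nonneg (α := ℝ)])) (Real.Gamma_pos_of_pos hn).ne']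
  rw [h, Real.deriv_Gamma_nat, Real.Gamma_nat_eq_factorial]
  field_simp

/-- For real `1 ≤ x ≤ 2`, log-convexity of the Gamma function yields the digamma series. -/
lemma tendsto_deriv_log_Gamma {x : ℝ} (h1 : 1 ≤ x) (h2 : x ≤ 2) :
    Tendsto (fun N => ∑ k ∈ Finset.range N, (1 / ((k : ℝ) + 1) - 1 / (x + k))) atTop
      (𝓝 (deriv (Real.log ∘ Real.Gamma) x + Real.eulerMascheroniConstant)) := by
  have hmono : MonotoneOn (deriv (Real.log ∘ Real.Gamma)) (Set.Ioi 0) :=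
    Real.convexOn_log_Gamma.monotoneOn_deriv fun y hy =>
      (Real.differentiableAt_Gamma fun m => ne_of_gt
        (by linarith [m.cast_nonneg (α := ℝ), Set.mem_Ioi.mp hy])).log
        (Real.Gamma_pos_of_pos hy).ne'
  have hx : 0 < x := by linarith
  have hharm : ∀ N : ℕ, ∑ k ∈ Finset.range N, 1 / ((k : ℝ) + 1) = harmonic N := fun N => by
    rw [harmonic]; push_cast
    exact Finset.sum_congr rfl fun _ _ => by rw [one_div]
  rw [← tendsto_sub_nhds_zero_iff]
  refine squeeze_zero_norm (a := fun N : ℕ => 1 / ((N : ℝ) + 1)) (fun N => ?_)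
    tendsto_one_div_add_atTop_nhds_zero_nat
  have e := deriv_log_Gamma_add_natCast hx N
  -- As x + N lies between N + 1 and N + 2, monotonicity traps the value between H_N - γ and H_(N+1)
  -- - γ, which differ by 1/(N+1).
  have lo : deriv (Real.log ∘ Real.Gamma) (N + 1) ≤ deriv (Real.log ∘ Real.Gamma) (x + N) :=
    hmono (Set.mem_Ioi.mpr (by positivity)) (Set.mem_Ioi.mpr (by positivity)) (by linarith)
  have hi : deriv (Real.log ∘ Real.Gamma) (x + N) ≤
      deriv (Real.log ∘ Real.Gamma) ((N + 1 : ℕ) + 1) :=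
    hmono (Set.mem_Ioi.mpr (by positivity)) (Set.mem_Ioi.mpr (by positivity))
      (by push_cast; linarith)
  rw [deriv_log_Gamma_natCast_add_one] at lo hi
  rw [harmonic_succ] at hi
  push_cast at hi
  rw [Finset.sum_sub_distrib, hharm, Real.norm_eq_abs, abs_le, one_div]
  constructor <;> linarith

lemma digamma_ofReal {x : ℝ} (hx : 0 < x) :
    Complex.digamma x = ((deriv (Real.log ∘ Real.Gamma) x : ℝ) : ℂ) := by
  have hdR : DifferentiableAt ℝ Real.Gamma x := Real.differentiableAt_Gamma fun m =>
    ne_of_gt (by linarith [m.cast_nonneg (α := ℝ)])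
  have hdC : DifferentiableAt ℂ Complex.Gamma x := Complex.differentiableAt_Gamma _ fun m => by
    have : x ≠ -m := ne_of_gt (by linarith [m.cast_nonneg (α := ℝ)])
    exact_mod_cast this
  have h1 : deriv (fun y : ℝ => Complex.Gamma y) x = deriv Complex.Gamma x :=
    hdC.hasDerivAt.comp_ofReal.deriv
  have h2 : deriv (fun y : ℝ => ((Real.Gamma y : ℝ) : ℂ)) x = (deriv Real.Gamma x : ℝ) :=
    hdR.hasDerivAt.ofReal_comp.deriv
  rw [Function.comp_def, deriv.log hdR (Real.Gamma_pos_of_pos hx).ne', Complex.digamma_def,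
    logDeriv_apply, Complex.Gamma_ofReal, ← h1, funext fun y : ℝ => Complex.Gamma_ofReal y, h2,
    Complex.ofReal_div]

lemma natCast_half_le_norm_add {z : ℂ} (hz : 1 / 2 < z.re) (k : ℕ) :
    ((k : ℝ) + 1) / 2 ≤ ‖z + k‖ := by
  have h := Complex.re_le_norm (z + k)
  have : (0 : ℝ) ≤ k := k.cast_nonneg
  simp at h
  linarith

lemma norm_digamma_term_le {z : ℂ} {R : ℝ} (hz : 1 / 2 < z.re) (hR : ‖z‖ ≤ R) (k : ℕ) :
    ‖1 / ((k : ℂ) + 1) - 1 / (z + k)‖ ≤ 2 * (R + 1) * (1 / ((k + 1 : ℕ) : ℝ) ^ 2) := by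
  have h1 := natCast_half_le_norm_add hz k
  have hk : (0 : ℝ) < (k : ℝ) + 1 := by positivity
  have hzk : z + k ≠ 0 := norm_pos_iff.mp (by linarith)
  have hk' : (k : ℂ) + 1 ≠ 0 := by exact_mod_cast hk.ne'
  have e : 1 / ((k : ℂ) + 1) - 1 / (z + k) = (z - 1) / (((k : ℂ) + 1) * (z + k)) := by
    field_simp
    ring
  have hkn : ‖(k : ℂ) + 1‖ = (k : ℝ) + 1 := by
    rw [← Nat.cast_succ, Complex.norm_natCast, Nat.cast_succ]
  have hz1 : ‖z - 1‖ ≤ R + 1 := (norm_sub_le _ _).trans (by rw [norm_one]; linarith)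
  rw [e, norm_div, norm_mul, hkn, mul_one_div]
  push_cast
  rw [div_le_div_iff₀ (by positivity) (by positivity)]
  have hR0 : 0 ≤ R + 1 := (norm_nonneg _).trans hz1
  calc ‖z - 1‖ * ((k : ℝ) + 1) ^ 2 ≤ (R + 1) * ((k : ℝ) + 1) ^ 2 := by gcongr
    _ = 2 * (R + 1) * (((k : ℝ) + 1) * (((k : ℝ) + 1) / 2)) := by ring
    _ ≤ _ := by gcongr

lemma summable_nat_add_one_inv_sq : Summable fun k : ℕ => 1 / ((k + 1 : ℕ) : ℝ) ^ 2 :=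
  (summable_nat_add_iff (f := fun k : ℕ => 1 / (k : ℝ) ^ 2) 1).mpr
    (Real.summable_one_div_nat_pow.mpr one_lt_two)

/-- The series expansion of the digamma function. -/
lemma hasSum_digamma {z : ℂ} (hz : 1 / 2 < z.re) :
    HasSum (fun k : ℕ => 1 / ((k : ℂ) + 1) - 1 / (z + k))
      (Complex.digamma z + Real.eulerMascheroniConstant) := by
  have hsum : ∀ {w : ℂ}, 1 / 2 < w.re → Summable fun k : ℕ => 1 / ((k : ℂ) + 1) - 1 / (w + k) :=
    fun {w} hw => Summable.of_norm_bounded (summable_nat_add_one_inv_sq.mul_left _)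
      (norm_digamma_term_le hw le_rfl)
  -- The identity theorem will carry the formula from real points to z. Intersecting the half-plane
  -- with a ball keeps the majorant of the series uniform.
  let U : Set ℂ := {w | 1 / 2 < w.re} ∩ Metric.ball 0 (‖z‖ + 3)
  have hUo : IsOpen U := (isOpen_lt continuous_const Complex.continuous_re).inter Metric.isOpen_ball
  have hUc : IsPreconnected U :=
    ((convex_halfSpace_re_gt _).inter (convex_ball _ _)).isPreconnected
  have hne : ∀ w ∈ U, ∀ k : ℕ, w + k ≠ 0 := fun w hw k => by
    have := natCast_half_le_norm_add hw.1 k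
    exact norm_pos_iff.mp (lt_of_lt_of_le (by positivity) this)
  have hf : AnalyticOnNhd ℂ (fun w => Complex.digamma w + Real.eulerMascheroniConstant) U := by
    refine DifferentiableOn.analyticOnNhd (fun w hw => ?_) hUo
    have hw0 : 0 < w.re := lt_trans (by norm_num) hw.1
    have hG : AnalyticAt ℂ Complex.Gamma w := by
      refine DifferentiableOn.analyticAt (s := {w : ℂ | 0 < w.re}) (fun y hy => ?_)
        ((isOpen_lt continuous_const Complex.continuous_re).mem_nhds hw0)
      refine (Complex.differentiableAt_Gamma y fun m h => ?_).differentiableWithinAt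
      rw [Set.mem_ofPred_eq, h] at hy
      simp at hy
      linarith [m.cast_nonneg (α := ℝ)]
    exact ((hG.deriv.div hG (Complex.Gamma_ne_zero_of_re_pos hw0)).differentiableAt.add_const
      _).differentiableWithinAt
  have hg : AnalyticOnNhd ℂ (fun w => ∑' k : ℕ, (1 / ((k : ℂ) + 1) - 1 / (w + k))) U := by
    refine DifferentiableOn.analyticOnNhd ?_ hUo
    refine Complex.differentiableOn_tsum_of_summable_norm
      (summable_nat_add_one_inv_sq.mul_left (2 * (‖z‖ + 3 + 1))) (fun k w hw => ?_) hUo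
      (fun k w hw => norm_digamma_term_le hw.1 (mem_ball_zero_iff.mp hw.2).le k)
    have := hne w hw k
    refine DifferentiableAt.differentiableWithinAt ?_
    fun_prop (disch := assumption)
  have hreal : ∀ x : ℝ, 1 ≤ x → x ≤ 2 → Complex.digamma x + Real.eulerMascheroniConstant =
      ∑' k : ℕ, (1 / ((k : ℂ) + 1) - 1 / ((x : ℂ) + k)) := by
    intro x h1 h2
    have hs := (hsum (w := x) (by rw [Complex.ofReal_re]; linarith)).hasSum.tendsto_sum_nat
    have ht := (Complex.continuous_ofReal.tendsto _).comp (tendsto_deriv_log_Gamma h1 h2)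
    rw [digamma_ofReal (by linarith)]
    refine tendsto_nhds_unique (ht.congr fun N => ?_) hs |>.symm ▸ ?_
    · simp
    · push_cast; rfl
  have h32 : (3 / 2 : ℂ) ∈ U := by
    refine ⟨?_, ?_⟩
    · simp; norm_num
    · rw [mem_ball_zero_iff]
      norm_num
      linarith [norm_nonneg z]
  -- The real points 3/2 + 1/(n+2) lie in [1, 2], accumulate at 3/2 and never equal it.
  have hfreq : ∃ᶠ w in 𝓝[≠] (3 / 2 : ℂ), Complex.digamma w + Real.eulerMascheroniConstant =
      ∑' k : ℕ, (1 / ((k : ℂ) + 1) - 1 / (w + k)) := by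
    have ht : Tendsto (fun n : ℕ => (((3 / 2 : ℝ) + 1 / ((n : ℝ) + 2) : ℝ) : ℂ)) atTop
        (𝓝[≠] (3 / 2 : ℂ)) := by
      rw [tendsto_nhdsWithin_iff]
      constructor
      · have : Tendsto (fun n : ℕ => (3 / 2 : ℝ) + 1 / ((n : ℝ) + 2)) atTop (𝓝 (3 / 2 + 0)) := by
          refine tendsto_const_nhds.add ?_
          have := (tendsto_one_div_add_atTop_nhds_zero_nat (𝕜 := ℝ)).comp (tendsto_add_atTop_nat 1)
          refine this.congr fun n => ?_
          simp only [Function.comp_apply]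
          push_cast
          ring
        have h := (Complex.continuous_ofReal.tendsto _).comp this
        simpa [Function.comp_def] using h
      · refine Eventually.of_forall fun n h => ?_
        have h' : (((3 / 2 : ℝ) + 1 / ((n : ℝ) + 2) : ℝ) : ℂ) = ((3 / 2 : ℝ) : ℂ) := by
          rw [h]; norm_num
        have h'' := Complex.ofReal_injective h'
        have : (0 : ℝ) < 1 / ((n : ℝ) + 2) := by positivity
        linarith
    refine ht.frequently (Eventually.of_forall fun n => ?_).frequently
    have h0 : (0 : ℝ) < 1 / ((n : ℝ) + 2) := by positivity
    have h1 : 1 / ((n : ℝ) + 2) ≤ 1 / 2 := by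
      gcongr
      linarith [n.cast_nonneg (α := ℝ)]
    exact hreal _ (by linarith) (by linarith)
  have hzU : z ∈ U := ⟨hz, by rw [mem_ball_zero_iff]; linarith⟩
  have := hf.eqOn_of_preconnected_of_frequently_eq hg hUc h32 hfreq hzU
  simp only at this
  rw [this]
  exact (hsum hz).hasSum

/-- The imaginary axis lies outside the half-plane of `hasSum_digamma`, so the series is used at w +
1 and brought back by ψ(w+1) = ψ(w) + 1/w. -/
lemma hasSum_digamma_of_re_eq_zero {w : ℂ} (hw : w.re = 0) (hw0 : w ≠ 0) :
    HasSum (fun k : ℕ+ => 1 / (k : ℂ) - 1 / (w + k))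
      (Complex.digamma w + 1 / w + Real.eulerMascheroniConstant) := by
  have h := hasSum_digamma (z := w + 1) (by rw [Complex.add_re, hw, Complex.one_re]; norm_num)
  rw [Complex.digamma_apply_add_one w fun m hm => ?_, ← one_div] at h
  · rw [← Equiv.pnatEquivNat.hasSum_iff] at h
    refine h.congr_of_eq (fun k => ?_) rfl
    have hk : ((Equiv.pnatEquivNat k : ℕ) : ℂ) + 1 = k := by
      have : Equiv.pnatEquivNat k + 1 = (k : ℕ) := by simp [Equiv.pnatEquivNat_apply]
      exact_mod_cast this
    rw [Function.comp_apply, add_assoc w, add_comm (1 : ℂ), hk]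
  · have := congrArg Complex.re hm
    rw [hw] at this
    simp at this
    exact hw0 (by rw [hm, this]; simp)

/-! ### Digamma values at ±ni and the sums with k² + n² -/

/-- The combination of digamma values entering `digammaTerm`. -/
noncomputable def digammaPair (p : ℕ) (n : ℕ+) : ℂ :=
  Complex.I ^ (p + 1)
    * (Complex.digamma (n * Complex.I) + (-1) ^ (p + 1) * Complex.digamma (-(n * Complex.I))
      + (1 + (-1) ^ (p + 1)) * Real.eulerMascheroniConstant)

lemma natCast_mul_I_ne_zero (n : ℕ+) : (n : ℂ) * Complex.I ≠ 0 :=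
  mul_ne_zero (by exact_mod_cast n.ne_zero) Complex.I_ne_zero

lemma mul_I_add_ne_zero (n k : ℕ+) : (n : ℂ) * Complex.I + k ≠ 0 := fun h => by
  have := congrArg Complex.re h
  simp at this

lemma neg_mul_I_add_ne_zero (n k : ℕ+) : -((n : ℂ) * Complex.I) + k ≠ 0 := fun h => by
  have := congrArg Complex.re h
  simp at this

lemma pnat_sq_add_sq_eq (n k : ℕ+) : (k : ℂ) ^ 2 + (n : ℂ) ^ 2 =
    ((n : ℂ) * Complex.I + k) * (-((n : ℂ) * Complex.I) + k) := by
  linear_combination (n : ℂ) ^ 2 * Complex.I_sq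

lemma digammaPair_zero (n : ℕ+) : digammaPair 0 n = -2 / n - 2 * n * addSum 0 n := by
  have hn : (n : ℂ) ≠ 0 := by exact_mod_cast n.ne_zero
  have h1 := hasSum_digamma_of_re_eq_zero (w := n * Complex.I) (by simp) (natCast_mul_I_ne_zero n)
  have h2 := hasSum_digamma_of_re_eq_zero (w := -(n * Complex.I)) (by simp)
    (neg_ne_zero.mpr (natCast_mul_I_ne_zero n))
  have h3 := (h1.sub h2).unique (((hasSum_addSum 0 n).mul_left (2 * n * Complex.I)).congr_of_eq
    (fun k => by
      rw [pow_zero, one_mul, pnat_sq_add_sq_eq]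
      have := mul_I_add_ne_zero n k
      have := neg_mul_I_add_ne_zero n k
      field_simp
      ring) rfl)
  have h4 : 1 / ((n : ℂ) * Complex.I) = -Complex.I / n := by
    rw [div_eq_div_iff (natCast_mul_I_ne_zero n) hn]
    linear_combination n * Complex.I_sq
  rw [div_neg, h4] at h3
  rw [digammaPair]
  linear_combination Complex.I * h3 + (2 / n + 2 * n * addSum 0 n) * Complex.I_sq

lemma digammaPair_one (n : ℕ+) : digammaPair 1 n = -2 * n ^ 2 * addSum 1 n := by
  have h1 := hasSum_digamma_of_re_eq_zero (w := n * Complex.I) (by simp) (natCast_mul_I_ne_zero n)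
  have h2 := hasSum_digamma_of_re_eq_zero (w := -(n * Complex.I)) (by simp)
    (neg_ne_zero.mpr (natCast_mul_I_ne_zero n))
  have h3 := (h1.add h2).unique (((hasSum_addSum 1 n).mul_left (2 * (n : ℂ) ^ 2)).congr_of_eq
    (fun k => by
      have hk : (k : ℂ) ≠ 0 := by exact_mod_cast k.ne_zero
      have e : (n : ℂ) ^ 2 = ((n : ℂ) * Complex.I + k) * (-((n : ℂ) * Complex.I) + k) - k ^ 2 := by
        rw [← pnat_sq_add_sq_eq]; ring
      rw [pow_one, pnat_sq_add_sq_eq, e]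
      have := mul_I_add_ne_zero n k
      have := neg_mul_I_add_ne_zero n k
      field_simp
      ring) rfl)
  rw [div_neg] at h3
  rw [digammaPair]
  linear_combination -h3 + (Complex.digamma (n * Complex.I) + Complex.digamma (-(n * Complex.I))
    + 2 * Real.eulerMascheroniConstant) * Complex.I_sq

lemma digammaPair_add_two (p : ℕ) (n : ℕ+) : digammaPair (p + 2) n = -digammaPair p n := by
  have h1 : (-1 : ℂ) ^ (p + 2 + 1) = (-1) ^ (p + 1) := by ring
  have h2 : Complex.I ^ (p + 2 + 1) = -Complex.I ^ (p + 1) := by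
    rw [show p + 2 + 1 = p + 1 + 2 by ring, pow_add, Complex.I_sq]; ring
  rw [digammaPair, digammaPair, h1, h2, neg_mul]

/-- Counterpart of `two_mul_diffSum_eq`: here the recurrence changes sign at each step, as does
`digammaPair`, whence the factors (-1)^j and (-1)^(p/2). The base cases subtract or add the digamma
series at ni and -ni. -/
lemma two_mul_addSum_eq (p : ℕ) (n : ℕ+) :
    2 * n * addSum p n + digammaPair p n / (n : ℂ) ^ p =
    2 * ∑ j ∈ Finset.range (p / 2), (-1) ^ j * riemannZeta ((p - 2 * j : ℕ) : ℂ)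
        / (n : ℂ) ^ (2 * j + 1) - (1 + (-1) ^ p) * (-1) ^ (p / 2) / (n : ℂ) ^ (p + 1) := by
  have hn : (n : ℂ) ≠ 0 := by exact_mod_cast n.ne_zero
  induction p using Nat.twoStepInduction with
  | zero =>
    rw [digammaPair_zero]
    simp
    field_simp
    ring
  | one =>
    rw [digammaPair_one]
    simp
    field_simp
    ring
  | more p ih _ =>
    have h2 : (-1 : ℂ) ^ (p + 2) = (-1) ^ p := by ring
    rw [sum_zeta_div_pow_add_two, addSum_add_two, digammaPair_add_two, h2,
      show (p + 2) / 2 = p / 2 + 1 by omega]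
    generalize ∑ j ∈ Finset.range (p / 2), (-1) ^ j * riemannZeta ((p - 2 * j : ℕ) : ℂ)
        / (n : ℂ) ^ (2 * j + 1) = S at *
    generalize addSum p n = X at *
    generalize digammaPair p n = Y at *
    have hQ : (n : ℂ) ^ p ≠ 0 := pow_ne_zero _ hn
    simp only [pow_add, pow_one] at ih ⊢
    generalize (n : ℂ) ^ p = Q at *
    generalize (-1 : ℂ) ^ p = s at *
    generalize (-1 : ℂ) ^ (p / 2) = t at *
    field_simp at ih ⊢
    linear_combination -ih

/-! ### Coefficients of the kernel and its partial fraction expansion -/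

/-- The residue `(-1)^n π / sinh(nπ)` of `π² / (sin(πs) sinh(πs))` at `s = n`. -/
noncomputable def cschCoeff (n : ℕ+) : ℂ :=
  (-1) ^ (n : ℕ) * Real.pi / Complex.sinh (n * Real.pi)

/-- The constant term of `π² / (sin(πs) sinh(πs))` at `s = n`. -/
noncomputable def cothCoeff (n : ℕ+) : ℂ :=
  -((-1) ^ (n : ℕ) * (Real.pi ^ 2 * Complex.cosh (n * Real.pi) / Complex.sinh (n * Real.pi) ^ 2))

lemma norm_cschCoeff_le (n : ℕ+) : ‖cschCoeff n‖ ≤ 2 * Real.pi * Real.exp (-1 * (n : ℕ)) := by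
  have hn : (1 : ℝ) ≤ n := by exact_mod_cast n.pos
  have e : Complex.sinh ((n : ℂ) * Real.pi) = ((Real.sinh ((n : ℝ) * Real.pi) : ℝ) : ℂ) := by
    push_cast; rfl
  -- Because nπ ≥ n + 1 and e ≥ 2, exp(nπ) ≥ 2 exp(n), which leaves room for the subtracted exp(-nπ)
  -- ≤ 1 ≤ exp(n).
  have h1 : Real.exp n ≤ 2 * Real.sinh ((n : ℝ) * Real.pi) := by
    rw [Real.sinh_eq]
    have h2 : Real.exp (-(n * Real.pi)) ≤ 1 :=
      Real.exp_le_one_iff.mpr (by nlinarith [Real.pi_pos])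
    have h3 : Real.exp (n + 1) ≤ Real.exp (n * Real.pi) :=
      Real.exp_le_exp.mpr (by nlinarith [Real.pi_gt_three])
    have h4 : (2 : ℝ) ≤ Real.exp 1 := by linarith [Real.add_one_le_exp (1 : ℝ)]
    have h5 : (1 : ℝ) ≤ Real.exp n := Real.one_le_exp (by linarith)
    rw [Real.exp_add] at h3
    nlinarith
  have hpos : 0 < Real.exp (n : ℝ) := Real.exp_pos _
  rw [cschCoeff, e, norm_div, norm_mul, norm_neg_one_pow, one_mul, Complex.norm_real,
    Complex.norm_real, Real.norm_of_nonneg Real.pi_pos.le, Real.norm_of_nonneg (by linarith),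
    neg_one_mul, Real.exp_neg, ← div_eq_mul_inv, div_le_div_iff₀ (by linarith) hpos]
  nlinarith [Real.pi_pos]

lemma summable_norm_cschCoeff_mul_pow (j : ℕ) :
    Summable fun n : ℕ+ => ‖cschCoeff n‖ * (n : ℝ) ^ j := by
  have h := ((Real.summable_pow_mul_exp_neg_nat_mul j one_pos).comp_injective
    PNat.coe_injective).mul_left (2 * Real.pi)
  refine Summable.of_nonneg_of_le (fun n => by positivity) (fun n => ?_) h
  calc ‖cschCoeff n‖ * (n : ℝ) ^ j ≤ 2 * Real.pi * Real.exp (-1 * (n : ℕ)) * (n : ℝ) ^ j := by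
        gcongr
        exact norm_cschCoeff_le n
    _ = _ := by simp only [Function.comp_apply]; ring

lemma summable_cschCoeff_mul {f : ℕ+ → ℂ} {C : ℝ} {j : ℕ} (hf : ∀ n, ‖f n‖ ≤ C * (n : ℝ) ^ j) :
    Summable fun n : ℕ+ => cschCoeff n * f n := by
  refine Summable.of_norm_bounded ((summable_norm_cschCoeff_mul_pow j).mul_left C) fun n => ?_
  rw [norm_mul]
  calc ‖cschCoeff n‖ * ‖f n‖ ≤ ‖cschCoeff n‖ * (C * (n : ℝ) ^ j) := by gcongr; exact hf n
    _ = _ := by ring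

lemma summable_cschCoeff_div_pow (j : ℕ) : Summable fun n : ℕ+ => cschCoeff n / (n : ℂ) ^ j := by
  simp only [div_eq_mul_one_div (cschCoeff _)]
  refine summable_cschCoeff_mul (C := 1) (j := 0) fun n => ?_
  have hk : (1 : ℝ) ≤ (n : ℝ) ^ j := one_le_pow₀ (by exact_mod_cast one_le)
  rw [norm_div, norm_one, norm_pow, Complex.norm_natCast, pow_zero, one_mul]
  exact (div_le_one (by linarith)).mpr hk

/-- `∑_m (-1)^m / (n² + m²)`. -/
noncomputable def altAddSum (n : ℕ+) : ℂ :=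
  ∑' m : ℕ+, (-1 : ℂ) ^ (m : ℕ) * (1 / ((n : ℂ) ^ 2 + (m : ℂ) ^ 2))

lemma hasSum_altAddSum (n : ℕ+) :
    HasSum (fun m : ℕ+ => (-1 : ℂ) ^ (m : ℕ) * (1 / ((n : ℂ) ^ 2 + (m : ℂ) ^ 2)))
      (altAddSum n) := by
  refine (summable_neg_one_pow_mul (summable_pnat_of_le_inv_sq 1 fun m => ?_)).hasSum
  rw [add_comm]
  exact norm_one_div_sq_add_sq_le n m

lemma norm_altAddSum_le (n : ℕ+) : ‖altAddSum n‖ ≤ ∑' m : ℕ+, 1 / (m : ℝ) ^ 2 := by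
  refine tsum_of_norm_bounded summable_pnat_inv_sq.hasSum fun m => ?_
  rw [norm_mul, norm_neg_one_pow, one_mul, add_comm]
  simpa using norm_one_div_sq_add_sq_le n m

lemma cschCoeff_eq (n : ℕ+) :
    cschCoeff n = (-1) ^ (n : ℕ) * (1 / n + 2 * n * altAddSum n) := by
  have hn : (0 : ℝ) < n := by exact_mod_cast n.pos
  have h := Complex.hasSum_ofReal.mpr (hasSum_csch hn)
  have h1 := h.unique (((hasSum_altAddSum n).mul_left (2 * (n : ℂ))).congr_of_eq (fun m => by
    push_cast; ring) rfl)
  push_cast at h1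
  rw [mul_comm (Real.pi : ℂ)] at h1
  rw [cschCoeff, ← h1]
  ring

/-- Rests on 4n²/(n² + m²)² = 2/(n² + m²) - 2(m² - n²)/(n² + m²)², whose last term is that of the
differentiated csch series; this is where the cosh coefficient enters. -/
lemma hasSum_alternating_add_sq_inv_sq (n : ℕ+) :
    HasSum (fun m : ℕ+ => (-1 : ℂ) ^ (m : ℕ) * (1 / ((n : ℂ) ^ 2 + (m : ℂ) ^ 2) ^ 2))
      ((2 * altAddSum n - (1 / (n : ℂ) ^ 2 + (-1) ^ (n : ℕ) * cothCoeff n)) /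
        (4 * (n : ℂ) ^ 2)) := by
  have hn : (0 : ℝ) < n := by exact_mod_cast n.pos
  have hn' : (n : ℂ) ≠ 0 := by exact_mod_cast n.ne_zero
  have h := Complex.hasSum_ofReal.mpr (hasSum_csch_deriv hn)
  refine ((((hasSum_altAddSum n).mul_left 2).sub h).div_const (4 * (n : ℂ) ^ 2)).congr_of_eq
    (fun m => ?_) ?_
  · have := pnat_sq_add_sq_ne_zero n m
    push_cast
    field_simp
    ring
  · push_cast
    rw [cothCoeff, mul_comm (Real.pi : ℂ)]
    congr 2
    rw [mul_neg, ← mul_assoc, neg_one_pow_mul_self]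
    ring

/-- The double series behind the partial fraction expansion of `π² / (sin(πs) sinh(πs))`. -/
lemma tsum_altAddSum_div_sub (k : ℕ+) :
    ∑' n : ℕ+, (-1 : ℂ) ^ (n : ℕ) * (altAddSum n * (1 / ((k : ℂ) ^ 2 - (n : ℂ) ^ 2))) =
      altAddSum k * (-1 / (2 * (k : ℂ) ^ 2) - (-1) ^ (k : ℕ) / (4 * (k : ℂ) ^ 2))
      + ∑' n : ℕ+, (-1 : ℂ) ^ (n : ℕ) * (altAddSum n * (1 / ((k : ℂ) ^ 2 + (n : ℂ) ^ 2)))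
      - (-1) ^ (k : ℕ) * ((2 * altAddSum k - (1 / (k : ℂ) ^ 2 + (-1) ^ (k : ℕ) * cothCoeff k)) /
        (4 * (k : ℂ) ^ 2)) := by
  let f : ℕ+ → ℕ+ → ℂ := fun n m => (-1 : ℂ) ^ (n : ℕ) * (1 / ((k : ℂ) ^ 2 - (n : ℂ) ^ 2)) *
    ((-1 : ℂ) ^ (m : ℕ) * (1 / ((n : ℂ) ^ 2 + (m : ℂ) ^ 2)))
  have hf : Summable (Function.uncurry f) := by
    refine Summable.of_norm_bounded (((summable_pnat_inv_sq.mul_left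
      (1 + (k : ℝ) ^ 2)).mul_of_nonneg summable_pnat_inv_sq (fun n => by positivity)
      (fun n => by positivity))) ?_
    rintro ⟨n, m⟩
    simp only [Function.uncurry_apply_pair, f]
    rw [norm_mul, norm_mul, norm_mul, norm_neg_one_pow, norm_neg_one_pow, one_mul, one_mul]
    gcongr
    · have := norm_one_div_sq_sub_sq_le k n
      rwa [norm_div, norm_sub_rev, ← norm_div] at this
    · rw [add_comm]
      simpa using norm_one_div_sq_add_sq_le n m
  have hrow : ∀ n : ℕ+, ∑' m : ℕ+, f n m =
      (-1 : ℂ) ^ (n : ℕ) * (altAddSum n * (1 / ((k : ℂ) ^ 2 - (n : ℂ) ^ 2))) := fun n => by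
    simp only [f]
    rw [tsum_mul_left, altAddSum]
    ring
  -- For n ≠ k, 1/((k² - n²)(n² + m²)) = (1/(k² + m²))(1/(k² - n²) + 1/(n² + m²)). At n = k the left
  -- side is 0 by convention, so the second summand must be removed there.
  have hcol : ∀ m : ℕ+, ∑' n : ℕ+, f n m = (-1 : ℂ) ^ (m : ℕ) * (1 / ((k : ℂ) ^ 2 + (m : ℂ) ^ 2)) *
      ((-1 / (2 * (k : ℂ) ^ 2) - (-1) ^ (k : ℕ) / (4 * (k : ℂ) ^ 2)) + altAddSum m
        - (-1) ^ (k : ℕ) * (1 / ((k : ℂ) ^ 2 + (m : ℂ) ^ 2))) := fun m => by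
    have h3 : HasSum (fun n : ℕ+ => if n = k then
        (-1) ^ (k : ℕ) * (1 / ((k : ℂ) ^ 2 + (m : ℂ) ^ 2)) else 0)
        ((-1) ^ (k : ℕ) * (1 / ((k : ℂ) ^ 2 + (m : ℂ) ^ 2))) := hasSum_ite_eq k _
    refine HasSum.tsum_eq (((((hasSum_sign_pow_div_sq_sub_sq (ε := -1) (by norm_num) k).add
      (hasSum_altAddSum m)).sub h3).mul_left ((-1 : ℂ) ^ (m : ℕ) *
        (1 / ((k : ℂ) ^ 2 + (m : ℂ) ^ 2)))).congr_of_eq (fun n => ?_) rfl)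
    simp only [f]
    have e1 := pnat_sq_add_sq_ne_zero k m
    have e2 := pnat_sq_add_sq_ne_zero n m
    rw [add_comm ((m : ℂ) ^ 2)]
    split_ifs with h
    · subst h
      simp
    · have e3 := pnat_sq_sub_sq_ne_zero (Ne.symm h)
      field_simp
      ring
  have hZ : Summable fun n : ℕ+ =>
      (-1 : ℂ) ^ (n : ℕ) * (altAddSum n * (1 / ((k : ℂ) ^ 2 + (n : ℂ) ^ 2))) := by
    refine summable_neg_one_pow_mul
      (summable_pnat_of_le_inv_sq (∑' m : ℕ+, 1 / (m : ℝ) ^ 2) fun n => ?_)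
    rw [norm_mul]
    gcongr
    · exact norm_altAddSum_le n
    · rw [add_comm]
      simpa using norm_one_div_sq_add_sq_le k n
  have hswap := hf.tsum_comm
  simp only [hrow, hcol] at hswap
  rw [← hswap]
  have hE := hasSum_alternating_add_sq_inv_sq k
  rw [(((((hasSum_altAddSum k).mul_right (-1 / (2 * (k : ℂ) ^ 2) - (-1) ^ (k : ℕ) /
    (4 * (k : ℂ) ^ 2))).add hZ.hasSum).sub (hE.mul_left ((-1) ^ (k : ℕ)))).congr_of_eq
    (fun m => ?_) rfl).tsum_eq]
  have e1 := pnat_sq_add_sq_ne_zero k m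
  field_simp

/-- The partial fraction expansion of `π² / (sin(πs) sinh(πs))`, evaluated as the constant term
at the pole `s = k`. -/
lemma cothCoeff_eq (k : ℕ+) :
    cothCoeff k = 1 / (k : ℂ) ^ 2 - cschCoeff k / (2 * k)
      + ∑' n : ℕ+, cschCoeff n * (2 * n) * (1 / ((k : ℂ) ^ 2 - (n : ℂ) ^ 2))
      + ∑' n : ℕ+, cschCoeff n * (2 * n) * (1 / ((k : ℂ) ^ 2 + (n : ℂ) ^ 2)) := by
  have hk : (k : ℂ) ≠ 0 := by exact_mod_cast k.ne_zero
  have hs1 : Summable fun n : ℕ+ => cschCoeff n * (2 * n) * (1 / ((k : ℂ) ^ 2 - (n : ℂ) ^ 2)) := by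
    simp only [mul_assoc]
    refine summable_cschCoeff_mul (C := 2 * (1 + (k : ℝ) ^ 2)) (j := 1) fun n => ?_
    have h := norm_one_div_sq_sub_sq_le k n
    rw [norm_div, norm_sub_rev, ← norm_div] at h
    have h1 : 1 / (n : ℝ) ^ 2 ≤ 1 :=
      (div_le_one (by have := n.pos; positivity)).mpr (one_le_pow₀ (by exact_mod_cast one_le))
    rw [← mul_assoc, norm_mul, norm_mul, Complex.norm_natCast, Complex.norm_ofNat, pow_one]
    calc 2 * (n : ℝ) * ‖1 / ((k : ℂ) ^ 2 - (n : ℂ) ^ 2)‖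
        ≤ 2 * (n : ℝ) * ((1 + (k : ℝ) ^ 2) * 1) := by
          gcongr; exact h.trans (by gcongr)
      _ = _ := by ring
  have hs2 : Summable fun n : ℕ+ => cschCoeff n * (2 * n) * (1 / ((k : ℂ) ^ 2 + (n : ℂ) ^ 2)) := by
    simp only [mul_assoc]
    refine summable_cschCoeff_mul (C := 2) (j := 1) fun n => ?_
    have h := norm_one_div_sq_add_sq_le n k
    have h1 : 1 / (k : ℝ) ^ 2 ≤ 1 :=
      (div_le_one (by have := k.pos; positivity)).mpr (one_le_pow₀ (by exact_mod_cast one_le))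
    rw [← mul_assoc, norm_mul, norm_mul, Complex.norm_natCast, Complex.norm_ofNat, pow_one]
    calc 2 * (n : ℝ) * ‖1 / ((k : ℂ) ^ 2 + (n : ℂ) ^ 2)‖ ≤ 2 * (n : ℝ) * 1 := by
          gcongr; linarith
      _ = _ := by ring
  have hY : Summable fun n : ℕ+ =>
      (-1 : ℂ) ^ (n : ℕ) * (altAddSum n * (1 / ((k : ℂ) ^ 2 - (n : ℂ) ^ 2))) := by
    refine summable_neg_one_pow_mul (summable_pnat_of_le_inv_sq
      ((∑' m : ℕ+, 1 / (m : ℝ) ^ 2) * (1 + (k : ℝ) ^ 2)) fun n => ?_)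
    have := norm_one_div_sq_sub_sq_le k n
    rw [norm_div, norm_sub_rev, ← norm_div] at this
    rw [norm_mul, mul_assoc]
    gcongr
    · exact norm_altAddSum_le n
  have hZ : Summable fun n : ℕ+ =>
      (-1 : ℂ) ^ (n : ℕ) * (altAddSum n * (1 / ((k : ℂ) ^ 2 + (n : ℂ) ^ 2))) := by
    refine summable_neg_one_pow_mul
      (summable_pnat_of_le_inv_sq (∑' m : ℕ+, 1 / (m : ℝ) ^ 2) fun n => ?_)
    rw [norm_mul]
    gcongr
    · exact norm_altAddSum_le n
    · rw [add_comm]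
      simpa using norm_one_div_sq_add_sq_le k n
  have h3 : HasSum (fun n : ℕ+ => if n = k then 4 * (-1) ^ (k : ℕ) * altAddSum k else 0)
      (4 * (-1) ^ (k : ℕ) * altAddSum k) := hasSum_ite_eq k _
  -- Substituting `cschCoeff_eq` and n²/(k² ∓ n²) = ±(k²/(k² ∓ n²) - 1), the constants cancel and
  -- only the difference of the two double series remains, with a correction at n = k. In
  -- `tsum_altAddSum_div_sub` the series with k² + n² recurs on the right, so it drops out of this
  -- difference.
  have hT := (hs1.hasSum.add hs2.hasSum).unique
    ((((((hasSum_sign_pow_div_sq_sub_sq (ε := -1) (by norm_num) k).mul_left 2).add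
      ((hasSum_altAddSum k).mul_left 2)).add
      ((hY.hasSum.sub hZ.hasSum).mul_left (4 * (k : ℂ) ^ 2))).add h3).congr_of_eq (fun n => by
        have hn : (n : ℂ) ≠ 0 := by exact_mod_cast n.ne_zero
        have e1 := pnat_sq_add_sq_ne_zero k n
        rw [cschCoeff_eq]
        split_ifs with h
        · subst h
          simp only [sub_self, div_zero, mul_zero, zero_add]
          field_simp
          ring
        · have e3 := pnat_sq_sub_sq_ne_zero (Ne.symm h)
          field_simp
          ring) rfl)
  have hs := neg_one_pow_mul_self (k : ℕ)
  rw [tsum_altAddSum_div_sub] at hT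
  rw [add_assoc, hT, cschCoeff_eq]
  field_simp
  linear_combination (-8 * (k : ℂ) ^ 2 * cothCoeff k) * hs

/-! ### Reindexing the finite sums -/

lemma sum_pairsTwoTwo (j : ℕ) (F : ℕ × ℕ → ℂ) :
    ∑ q ∈ pairsTwoTwo (2 * (j + 1)), F q = ∑ i ∈ Finset.range j, F (j - i, i + 1) := by
  symm
  refine Finset.sum_bij (fun i _ => (j - i, i + 1)) (fun i hi => ?_) (fun a _ b _ h => ?_)
    (fun q hq => ?_) (fun _ _ => rfl)
  · simp only [pairsTwoTwo, Finset.mem_filter, Finset.mem_product, Finset.mem_Icc,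
      Finset.mem_range] at hi ⊢
    omega
  · simpa using congrArg Prod.snd h
  · simp only [pairsTwoTwo, Finset.mem_filter, Finset.mem_product, Finset.mem_Icc] at hq
    refine ⟨q.2 - 1, Finset.mem_range.mpr (by omega), Prod.ext ?_ ?_⟩ <;> simp only <;> omega

lemma sum_pairsTwoOne (p : ℕ) (F : ℕ × ℕ → ℂ) :
    ∑ q ∈ pairsTwoOne (p + 1), F q = ∑ j ∈ Finset.range (p / 2), F (j + 1, p - 2 * j - 1) := by
  symm
  refine Finset.sum_bij (fun j _ => (j + 1, p - 2 * j - 1)) (fun i hi => ?_) (fun a _ b _ h => ?_)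
    (fun q hq => ?_) (fun _ _ => rfl)
  · simp only [pairsTwoOne, Finset.mem_filter, Finset.mem_product, Finset.mem_Icc,
      Finset.mem_range] at hi ⊢
    omega
  · simpa using congrArg Prod.fst h
  · simp only [pairsTwoOne, Finset.mem_filter, Finset.mem_product, Finset.mem_Icc] at hq
    refine ⟨q.1 - 1, Finset.mem_range.mpr (by omega), Prod.ext ?_ ?_⟩ <;> simp only <;> omega

/-- Triples are fibred over j with n₁ + n₂ = j + 1, which fixes n₃ = p - 2j - 1; positivity of n₃ is
the bound j < p/2. -/
lemma sum_triplesTwoTwoOne (p : ℕ) (F : ℕ × ℕ × ℕ → ℂ) :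
    ∑ q ∈ triplesTwoTwoOne (p + 1), F q = ∑ j ∈ Finset.range (p / 2),
      ∑ q ∈ pairsTwoTwo (2 * (j + 1)), F (q.1, q.2, p - 2 * j - 1) := by
  rw [Finset.sum_sigma']
  symm
  refine Finset.sum_bij (fun x _ => (x.2.1, x.2.2, p - 2 * x.1 - 1)) (fun x hx => ?_)
    (fun a ha b hb h => ?_) (fun q hq => ?_) (fun _ _ => rfl)
  · simp only [triplesTwoTwoOne, pairsTwoTwo, Finset.mem_filter, Finset.mem_product,
      Finset.mem_Icc, Finset.mem_sigma, Finset.mem_range] at hx ⊢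
    omega
  · obtain ⟨a, a1, a2⟩ := a
    obtain ⟨b, b1, b2⟩ := b
    simp only [pairsTwoTwo, Finset.mem_filter, Finset.mem_product, Finset.mem_Icc,
      Finset.mem_sigma, Finset.mem_range, Prod.mk.injEq] at ha hb h
    obtain ⟨rfl, rfl, h3⟩ := h
    have : a = b := by omega
    subst this
    rfl
  · simp only [triplesTwoTwoOne, Finset.mem_filter, Finset.mem_product, Finset.mem_Icc] at hq
    refine ⟨⟨q.1 + q.2.1 - 1, q.1, q.2.1⟩, ?_, Prod.ext rfl (Prod.ext rfl ?_)⟩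
    · simp only [pairsTwoTwo, Finset.mem_filter, Finset.mem_product, Finset.mem_Icc,
        Finset.mem_sigma, Finset.mem_range]
      omega
    · simp only
      omega

/-! ### Power sums of the coefficients through alternating zeta values -/

lemma one_div_pow_add_one_div_pow_div_add {x y : ℂ} (hx : x ≠ 0) (hy : y ≠ 0) (hxy : x + y ≠ 0)
    {r : ℕ} (hr : Odd r) :
    (1 / x ^ r + 1 / y ^ r) * (1 / (x + y)) =
      ∑ i ∈ Finset.range r, (-1) ^ i * (1 / x ^ (r - i) * (1 / y ^ (i + 1))) := by
  have h := (Commute.all (1 / x) (-(1 / y))).geom_sum₂_mul r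
  rw [hr.neg_pow, sub_neg_eq_add, sub_neg_eq_add, one_div_pow, one_div_pow] at h
  rw [← h, ← Finset.sum_range_reflect, Finset.sum_mul, Finset.sum_mul]
  refine Finset.sum_congr rfl fun i hi => ?_
  have hi' := Finset.mem_range.mp hi
  rw [show r - 1 - (r - 1 - i) = i by omega, show r - i = r - 1 - i + 1 by omega, neg_pow,
    one_div_pow, one_div_pow]
  field_simp
  ring

lemma HasSum.mul_complex {ι κ : Type*} {F : ι → ℂ} {G : κ → ℂ} {a b : ℂ} (hF : HasSum F a)
    (hG : HasSum G b) : HasSum (fun x : ι × κ => F x.1 * G x.2) (a * b) :=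
  hF.mul hG (summable_mul_of_summable_norm hF.summable.norm hG.summable.norm)

/-- By `cschCoeff_eq` the series is an alternating zeta value plus twice the sum of (-1)^(n+m) /
(n^(2r)(n² + m²)). Adding the copy with n and m exchanged produces (n^(-2r) + m^(-2r)) / (n² + m²),
which for odd r is a finite sum of products of negative powers, so the variables separate. -/
lemma tsum_cschCoeff_div_pow_of_odd {r : ℕ} (hr : Odd r) :
    ∑' n : ℕ+, cschCoeff n / (n : ℂ) ^ (2 * r + 1) = -altZeta ((2 * (r + 1) : ℕ) : ℂ) +
      ∑ i ∈ Finset.range r, (-1) ^ i *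
        (altZeta ((2 * (r - i) : ℕ) : ℂ) * altZeta ((2 * (i + 1) : ℕ) : ℂ)) := by
  have hr0 : 1 ≤ r := hr.pos
  let f : ℕ+ → ℕ+ → ℂ := fun n m => (-1 : ℂ) ^ (n : ℕ) * (1 / (n : ℂ) ^ (2 * r)) *
    ((-1 : ℂ) ^ (m : ℕ) * (1 / ((n : ℂ) ^ 2 + (m : ℂ) ^ 2)))
  have hf : Summable (Function.uncurry f) := by
    refine Summable.of_norm_bounded ((summable_pnat_inv_sq.mul_of_nonneg summable_pnat_inv_sq
      (fun n => by positivity) (fun n => by positivity))) ?_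
    rintro ⟨n, m⟩
    simp only [Function.uncurry_apply_pair, f]
    rw [norm_mul, norm_mul, norm_mul, norm_neg_one_pow, norm_neg_one_pow, one_mul, one_mul]
    gcongr
    · rw [norm_div, norm_one, norm_pow, Complex.norm_natCast]
      have : (1 : ℝ) ≤ n := by exact_mod_cast n.pos
      gcongr
      omega
    · rw [add_comm]
      simpa using norm_one_div_sq_add_sq_le n m
  have hrow : ∀ n : ℕ+, ∑' m : ℕ+, f n m =
      (-1 : ℂ) ^ (n : ℕ) * (1 / (n : ℂ) ^ (2 * r)) * altAddSum n := fun n => by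
    simp only [f]
    rw [tsum_mul_left, altAddSum]
  have hfs : HasSum (Function.uncurry f) (∑' n : ℕ+, ∑' m : ℕ+, f n m) := by
    have := hf.hasSum
    rwa [hf.tsum_prod] at this
  have hfs' : HasSum (fun x : ℕ+ × ℕ+ => f x.2 x.1) (∑' n : ℕ+, ∑' m : ℕ+, f n m) :=
    (Equiv.prodComm ℕ+ ℕ+).hasSum_iff.mpr hfs
  have hprod : ∀ i ∈ Finset.range r, HasSum (fun x : ℕ+ × ℕ+ => (-1 : ℂ) ^ i *
      (((-1 : ℂ) ^ (x.1 : ℕ) * (1 / (x.1 : ℂ) ^ (2 * (r - i)))) *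
        ((-1 : ℂ) ^ (x.2 : ℕ) * (1 / (x.2 : ℂ) ^ (2 * (i + 1))))))
      ((-1) ^ i * (altZeta ((2 * (r - i) : ℕ) : ℂ) * altZeta ((2 * (i + 1) : ℕ) : ℂ))) := by
    intro i hi
    have hi' := Finset.mem_range.mp hi
    have h1 := hasSum_altZeta (k := 2 * (r - i)) (by omega)
    have h2 := hasSum_altZeta (k := 2 * (i + 1)) (by omega)
    exact ((h1.mul_complex h2).mul_left ((-1 : ℂ) ^ i)).congr_of_eq (fun _ => rfl) (by ring)
  have hsym := (hfs.add hfs').unique ((hasSum_sum hprod).congr_of_eq (fun x => by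
    obtain ⟨n, m⟩ := x
    have hn : (n : ℂ) ≠ 0 := by exact_mod_cast n.ne_zero
    have hm : (m : ℂ) ≠ 0 := by exact_mod_cast m.ne_zero
    have h := one_div_pow_add_one_div_pow_div_add (pow_ne_zero 2 hn) (pow_ne_zero 2 hm)
      (pnat_sq_add_sq_ne_zero n m) hr
    simp only [← pow_mul] at h
    simp only [Function.uncurry_apply_pair, f]
    rw [add_comm ((m : ℂ) ^ 2)]
    calc _ = (-1 : ℂ) ^ (n : ℕ) * (-1 : ℂ) ^ (m : ℕ) *
          ((1 / (n : ℂ) ^ (2 * r) + 1 / (m : ℂ) ^ (2 * r)) *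
            (1 / ((n : ℂ) ^ 2 + (m : ℂ) ^ 2))) := by ring
      _ = _ := by
        rw [h, Finset.mul_sum]
        exact Finset.sum_congr rfl fun i _ => by ring) rfl)
  have hrows : Summable fun n : ℕ+ => ∑' m : ℕ+, f n m := hf.prod
  rw [← hsym]
  refine (((hasSum_altZeta (k := 2 * (r + 1)) (by omega)).add
    (hrows.hasSum.add hrows.hasSum)).congr_of_eq (fun n => ?_) rfl).tsum_eq
  have hn : (n : ℂ) ≠ 0 := by exact_mod_cast n.ne_zero
  rw [hrow, cschCoeff_eq]
  field_simp
  ring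

/-- The coefficients of `π² s² / (sin(πs) sinh(πs))` at `s = 0`. -/
lemma tsum_cschCoeff_div_pow (j : ℕ) :
    -2 * (1 + (-1) ^ (j + 1)) * ∑' n : ℕ+, cschCoeff n / (n : ℂ) ^ (2 * j + 1) =
      2 * (1 + (-1) ^ (j + 1)) * altZeta ((2 * (j + 1) : ℕ) : ℂ) +
      4 * ∑ q ∈ pairsTwoTwo (2 * (j + 1)),
        (-1 : ℂ) ^ q.2 * altZeta ((2 * q.1 : ℕ) : ℂ) * altZeta ((2 * q.2 : ℕ) : ℂ) := by
  rw [sum_pairsTwoTwo]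
  rcases Nat.even_or_odd j with he | ho
  · rw [he.add_one.neg_one_pow]
    -- For even j the reflection exchanging the two indices reverses the sign, so the sum over pairs
    -- is its own negative.
    have h : ∑ i ∈ Finset.range j, (-1 : ℂ) ^ (i + 1) * altZeta ((2 * (j - i) : ℕ) : ℂ)
          * altZeta ((2 * (i + 1) : ℕ) : ℂ) =
        -∑ i ∈ Finset.range j, (-1 : ℂ) ^ (i + 1) * altZeta ((2 * (j - i) : ℕ) : ℂ)
          * altZeta ((2 * (i + 1) : ℕ) : ℂ) := by
      conv_lhs => rw [← Finset.sum_range_reflect]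
      rw [← Finset.sum_neg_distrib]
      refine Finset.sum_congr rfl fun i hi => ?_
      have hi' := Finset.mem_range.mp hi
      have hpow : (-1 : ℂ) ^ (j - 1 - i + 1) = -(-1) ^ (i + 1) := by
        have h1 : (-1 : ℂ) ^ (j - 1 - i + 1) * (-1) ^ i = 1 := by
          rw [← pow_add, show j - 1 - i + 1 + i = j by omega, he.neg_one_pow]
        have h2 := neg_one_pow_mul_self i
        rw [pow_succ (-1 : ℂ) i]
        linear_combination (-1 : ℂ) ^ i * h1 - (-1 : ℂ) ^ (j - 1 - i + 1) * h2
      rw [hpow, show j - (j - 1 - i) = i + 1 by omega, show j - 1 - i + 1 = j - i by omega]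
      ring
    linear_combination -2 * h
  · rw [ho.add_one.neg_one_pow, tsum_cschCoeff_div_pow_of_odd ho]
    have h : ∑ i ∈ Finset.range j, (-1 : ℂ) ^ (i + 1) * altZeta ((2 * (j - i) : ℕ) : ℂ)
          * altZeta ((2 * (i + 1) : ℕ) : ℂ) =
        -∑ i ∈ Finset.range j, (-1 : ℂ) ^ i * (altZeta ((2 * (j - i) : ℕ) : ℂ)
          * altZeta ((2 * (i + 1) : ℕ) : ℂ)) := by
      rw [← Finset.sum_neg_distrib]
      exact Finset.sum_congr rfl fun i _ => by ring
    rw [h]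
    ring

/-! ### Convergence of the four series and assembly of the identity -/

lemma coshTerm_eq (p : ℕ) (n : ℕ+) : coshTerm p n = -(cothCoeff n / (n : ℂ) ^ p) := by
  rw [coshTerm, cothCoeff]
  field_simp

lemma cschTerm_eq (p : ℕ) (n : ℕ+) : cschTerm p n = cschCoeff n / (n : ℂ) ^ (p + 1) := by
  rw [cschTerm, cschCoeff]
  field_simp

lemma harmonicTerm_eq (p : ℕ) (n : ℕ+) :
    harmonicTerm p n = cschCoeff n * ((harmonic (n : ℕ) : ℂ) / (n : ℂ) ^ p) := by
  rw [harmonicTerm, cschCoeff]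
  field_simp

lemma digammaTerm_eq (p : ℕ) (n : ℕ+) :
    digammaTerm p n = cschCoeff n * (digammaPair p n / (n : ℂ) ^ p) := by
  rw [digammaTerm, cschCoeff, digammaPair]
  field_simp

lemma summable_cschTerm (p : ℕ) : Summable (cschTerm p) :=
  (summable_cschCoeff_div_pow (p + 1)).congr fun n => (cschTerm_eq p n).symm

lemma norm_harmonic_le (n : ℕ) : ‖(harmonic n : ℂ)‖ ≤ n := by
  rw [harmonic]
  push_cast
  refine (norm_sum_le_of_le (Finset.range n) (f := fun i : ℕ => ((i : ℂ) + 1)⁻¹)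
    (n := fun _ => (1 : ℝ)) fun i _ => ?_).trans (by simp)
  rw [norm_inv, ← Nat.cast_succ, Complex.norm_natCast]
  exact inv_le_one_of_one_le₀ (by exact_mod_cast i.succ_pos)

lemma norm_one_div_pnat_pow_le (p : ℕ) (n : ℕ+) : ‖1 / (n : ℂ) ^ p‖ ≤ 1 := by
  have hk : (1 : ℝ) ≤ (n : ℝ) ^ p := one_le_pow₀ (by exact_mod_cast one_le)
  rw [norm_div, norm_one, norm_pow, Complex.norm_natCast]
  exact (div_le_one (by linarith)).mpr hk

lemma summable_harmonicTerm (p : ℕ) : Summable (harmonicTerm p) := by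
  refine (summable_cschCoeff_mul (f := fun n => (harmonic (n : ℕ) : ℂ) / (n : ℂ) ^ p) (C := 1)
    (j := 1) fun n => ?_).congr fun n => (harmonicTerm_eq p n).symm
  rw [div_eq_mul_one_div, norm_mul, one_mul, pow_one]
  exact (mul_le_of_le_one_right (norm_nonneg _) (norm_one_div_pnat_pow_le p n)).trans
    (norm_harmonic_le n)

/-- Interchanging a summation against the rapidly decaying coefficients `cschCoeff`. -/
lemma hasSum_cschCoeff_swap {g : ℕ+ → ℕ+ → ℂ}
    (hg : ∀ n k, ‖g n k‖ ≤ (1 + (n : ℝ) ^ 2) * (1 / (k : ℝ) ^ 2)) :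
    Summable (fun k : ℕ+ => ∑' n : ℕ+, cschCoeff n * (2 * n) * g n k) ∧
    Summable (fun n : ℕ+ => cschCoeff n * (2 * n * ∑' k : ℕ+, g n k)) ∧
    ∑' k : ℕ+, ∑' n : ℕ+, cschCoeff n * (2 * n) * g n k =
      ∑' n : ℕ+, cschCoeff n * (2 * n * ∑' k : ℕ+, g n k) := by
  have hf : Summable (Function.uncurry fun n k : ℕ+ => cschCoeff n * (2 * n) * g n k) := by
    refine Summable.of_norm_bounded ((((summable_norm_cschCoeff_mul_pow 3).mul_left 4).mul_of_nonneg
      summable_pnat_inv_sq (fun n => by positivity) (fun n => by positivity))) ?_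
    rintro ⟨n, k⟩
    simp only [Function.uncurry_apply_pair]
    have hn : (1 : ℝ) ≤ n := by exact_mod_cast n.pos
    rw [norm_mul, norm_mul, norm_mul, Complex.norm_natCast, Complex.norm_ofNat]
    calc ‖cschCoeff n‖ * (2 * n) * ‖g n k‖
        ≤ ‖cschCoeff n‖ * (2 * n) * ((1 + (n : ℝ) ^ 2) * (1 / (k : ℝ) ^ 2)) := by
          gcongr; exact hg n k
      _ ≤ ‖cschCoeff n‖ * (2 * n) * (((n : ℝ) ^ 2 + (n : ℝ) ^ 2) * (1 / (k : ℝ) ^ 2)) := by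
          gcongr; exact one_le_pow₀ hn
      _ = _ := by ring
  have hrow : ∀ n : ℕ+, ∑' k : ℕ+, cschCoeff n * (2 * n) * g n k =
      cschCoeff n * (2 * n * ∑' k : ℕ+, g n k) := fun n => by
    rw [tsum_mul_left, mul_assoc]
  refine ⟨hf.prod_symm.prod, hf.prod.congr fun n => hrow n, ?_⟩
  rw [hf.tsum_comm]
  exact tsum_congr hrow

lemma norm_addSum_term_le' (p : ℕ) (n k : ℕ+) :
    ‖1 / ((k : ℂ) ^ p * ((k : ℂ) ^ 2 + (n : ℂ) ^ 2))‖ ≤ (1 + (n : ℝ) ^ 2) * (1 / (k : ℝ) ^ 2) :=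
  (norm_addSum_term_le p n k).trans (by gcongr; nlinarith [sq_nonneg (n : ℝ)])

/-- Divide `cothCoeff_eq` by k^p and sum over k; the decay of `cschCoeff` permits interchanging both
double sums. -/
lemma hasSum_cothCoeff (p : ℕ) :
    HasSum (fun k : ℕ+ => cothCoeff k / (k : ℂ) ^ p)
      (riemannZeta (p + 2 : ℕ) - (∑' n, cschTerm p n) / 2
        + ∑' n : ℕ+, cschCoeff n * (2 * n * diffSum p n)
        + ∑' n : ℕ+, cschCoeff n * (2 * n * addSum p n)) := by
  obtain ⟨h1, -, h1'⟩ := hasSum_cschCoeff_swap (norm_diffSum_term_le p)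
  obtain ⟨h2, -, h2'⟩ := hasSum_cschCoeff_swap (norm_addSum_term_le' p)
  simp only [diffSum, addSum]
  rw [← h1', ← h2']
  refine ((((hasSum_riemannZeta (by omega : 2 ≤ p + 2)).sub
    ((summable_cschTerm p).hasSum.div_const 2)).add h1.hasSum).add h2.hasSum).congr_of_eq
    (fun k => ?_) rfl
  have hk : (k : ℂ) ≠ 0 := by exact_mod_cast k.ne_zero
  have e1 : ∀ (z : ℕ+ → ℂ), ∑' n : ℕ+, cschCoeff n * (2 * n) * (1 / ((k : ℂ) ^ p * z n)) =
      (∑' n : ℕ+, cschCoeff n * (2 * n) * (1 / z n)) * (1 / (k : ℂ) ^ p) := fun z => by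
    rw [← tsum_mul_right]
    refine tsum_congr fun n => ?_
    rw [← one_div_mul_one_div]
    ring
  rw [e1 fun n => (k : ℂ) ^ 2 - (n : ℂ) ^ 2, e1 fun n => (k : ℂ) ^ 2 + (n : ℂ) ^ 2, cschTerm_eq,
    cothCoeff_eq, pow_add, pow_add]
  field_simp

lemma summable_coshTerm (p : ℕ) : Summable (coshTerm p) :=
  (hasSum_cothCoeff p).summable.neg.congr fun n => (coshTerm_eq p n).symm

lemma summable_cschCoeff_mul_addSum (p : ℕ) :
    Summable fun n : ℕ+ => cschCoeff n * (2 * n * addSum p n) :=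
  (hasSum_cschCoeff_swap (norm_addSum_term_le' p)).2.1

lemma summable_cschCoeff_mul_diffSum (p : ℕ) :
    Summable fun n : ℕ+ => cschCoeff n * (2 * n * diffSum p n) :=
  (hasSum_cschCoeff_swap (norm_diffSum_term_le p)).2.1

lemma hasSum_cschCoeff_mul_zetaSum (c : ℂ) (p : ℕ) :
    HasSum (fun n : ℕ+ => cschCoeff n * ∑ j ∈ Finset.range (p / 2),
      c ^ j * riemannZeta ((p - 2 * j : ℕ) : ℂ) / (n : ℂ) ^ (2 * j + 1))
      (∑ j ∈ Finset.range (p / 2), c ^ j * riemannZeta ((p - 2 * j : ℕ) : ℂ) *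
        ∑' n : ℕ+, cschCoeff n / (n : ℂ) ^ (2 * j + 1)) := by
  refine (hasSum_sum fun j _ => ((summable_cschCoeff_div_pow (2 * j + 1)).hasSum.mul_left
    (c ^ j * riemannZeta ((p - 2 * j : ℕ) : ℂ)))).congr_of_eq (fun n => ?_) rfl
  rw [Finset.mul_sum]
  exact Finset.sum_congr rfl fun j _ => by ring

/-- No growth estimate for ψ is needed: `two_mul_addSum_eq` expresses the term through series
already known to converge. -/
lemma summable_digammaTerm (p : ℕ) : Summable (digammaTerm p) := by
  refine (((((hasSum_cschCoeff_mul_zetaSum (-1) p).summable.mul_left 2).sub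
    ((summable_cschCoeff_div_pow (p + 1)).mul_left ((1 + (-1) ^ p) * (-1) ^ (p / 2)))).sub
    (summable_cschCoeff_mul_addSum p))).congr fun n => ?_
  rw [digammaTerm_eq]
  linear_combination cschCoeff n * -two_mul_addSum_eq p n

/-- The sum of the residues, expressed through the power sums of `cschCoeff`. -/
lemma sum_residues_eq (p : ℕ) :
    (1 + (-1 : ℂ) ^ (p + 1)) * ∑' n : ℕ+, harmonicTerm p n
      - ((p : ℂ) + (-1) ^ (p + 1)) * ∑' n : ℕ+, cschTerm p n
      - ∑' n : ℕ+, coshTerm p n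
      + ∑' n : ℕ+, digammaTerm p n =
    riemannZeta (p + 2 : ℕ)
      + ∑ j ∈ Finset.range (p / 2), riemannZeta ((p - 2 * j : ℕ) : ℂ) *
        (-2 * (1 + (-1) ^ (j + 1)) * ∑' n : ℕ+, cschCoeff n / (n : ℂ) ^ (2 * j + 1))
      + (1 + (-1) ^ p) * (1 - (-1) ^ (p / 2)) * ∑' n : ℕ+, cschCoeff n / (n : ℂ) ^ (p + 1) := by
  have hcosh : ∑' n, coshTerm p n = -∑' n : ℕ+, cothCoeff n / (n : ℂ) ^ p := by
    rw [← tsum_neg]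
    exact tsum_congr (coshTerm_eq p)
  have hcsch : ∑' n, cschTerm p n = ∑' n : ℕ+, cschCoeff n / (n : ℂ) ^ (p + 1) :=
    tsum_congr (cschTerm_eq p)
  have hD := ((summable_cschCoeff_mul_diffSum p).hasSum.add
    ((summable_harmonicTerm p).hasSum.mul_left (1 + (-1 : ℂ) ^ (p + 1)))).sub
    ((summable_cschTerm p).hasSum.mul_left (p + (-1 : ℂ) ^ (p + 1) + 1 / 2))
  have hA := (summable_cschCoeff_mul_addSum p).hasSum.add (summable_digammaTerm p).hasSum
  have hD' := hD.unique ((((hasSum_cschCoeff_mul_zetaSum 1 p).mul_left (-2)).add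
    ((summable_cschCoeff_div_pow (p + 1)).hasSum.mul_left (1 + (-1) ^ p))).congr_of_eq
    (fun n => by
      rw [harmonicTerm_eq, cschTerm_eq]
      linear_combination cschCoeff n * two_mul_diffSum_eq p n) rfl)
  have hA' := hA.unique ((((hasSum_cschCoeff_mul_zetaSum (-1) p).mul_left 2).sub
    ((summable_cschCoeff_div_pow (p + 1)).hasSum.mul_left
      ((1 + (-1) ^ p) * (-1) ^ (p / 2)))).congr_of_eq
    (fun n => by
      rw [digammaTerm_eq]
      linear_combination cschCoeff n * two_mul_addSum_eq p n) rfl)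
  -- The zeta sums from the two inner series combine with weight -2 + 2(-1)^j, so only odd j
  -- contribute.
  have hsplit : ∑ j ∈ Finset.range (p / 2), riemannZeta ((p - 2 * j : ℕ) : ℂ) *
        (-2 * (1 + (-1) ^ (j + 1)) * ∑' n : ℕ+, cschCoeff n / (n : ℂ) ^ (2 * j + 1)) =
      -2 * (∑ j ∈ Finset.range (p / 2), 1 ^ j * riemannZeta ((p - 2 * j : ℕ) : ℂ) *
        ∑' n : ℕ+, cschCoeff n / (n : ℂ) ^ (2 * j + 1)) +
      2 * ∑ j ∈ Finset.range (p / 2), (-1) ^ j * riemannZeta ((p - 2 * j : ℕ) : ℂ) *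
        ∑' n : ℕ+, cschCoeff n / (n : ℂ) ^ (2 * j + 1) := by
    rw [Finset.mul_sum, Finset.mul_sum, ← Finset.sum_add_distrib]
    exact Finset.sum_congr rfl fun j _ => by rw [one_pow]; ring
  rw [hcosh, (hasSum_cothCoeff p).tsum_eq, hsplit]
  rw [hcsch] at hD' ⊢
  linear_combination hD' + hA'

theorem theorem5p2 (p : ℕ) (hp : 1 ≤ p) :
    Summable (harmonicTerm p) ∧ Summable (cschTerm p) ∧ Summable (coshTerm p) ∧
    Summable (digammaTerm p) ∧
    (1 + (-1 : ℂ) ^ (p + 1)) * ∑' n : ℕ+, harmonicTerm p n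
      - ((p : ℂ) + (-1) ^ (p + 1)) * ∑' n : ℕ+, cschTerm p n
      - ∑' n : ℕ+, coshTerm p n
      + ∑' n : ℕ+, digammaTerm p n
      + riemannZeta ((p + 2 : ℕ) : ℂ)
        * ((1 - (2 : ℂ) ^ (-(p : ℤ) - 1)) * (1 + (-1) ^ p) * (1 + (-1) ^ (p / 2 + 1)) - 1)
      - 2 * ∑ q ∈ pairsTwoOne (p + 1),
          (1 + (-1 : ℂ) ^ q.1) * altZeta ((2 * q.1 : ℕ) : ℂ) * riemannZeta ((q.2 + 1 : ℕ) : ℂ)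
      + 2 * (1 + (-1 : ℂ) ^ p) * ∑ q ∈ pairsTwoTwo (p + 2),
          (-1 : ℂ) ^ q.2 * altZeta ((2 * q.1 : ℕ) : ℂ) * altZeta ((2 * q.2 : ℕ) : ℂ)
      - 4 * ∑ q ∈ triplesTwoTwoOne (p + 1),
          (-1 : ℂ) ^ q.2.1 * altZeta ((2 * q.1 : ℕ) : ℂ) * altZeta ((2 * q.2.1 : ℕ) : ℂ)
            * riemannZeta ((q.2.2 + 1 : ℕ) : ℂ)
      = 0 := by
  refine ⟨summable_harmonicTerm p, summable_cschTerm p, summable_coshTerm p,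
    summable_digammaTerm p, ?_⟩
  rw [sum_residues_eq, sum_pairsTwoOne, sum_triplesTwoTwoOne]
  have hsum : ∑ j ∈ Finset.range (p / 2), riemannZeta ((p - 2 * j : ℕ) : ℂ) *
        (-2 * (1 + (-1) ^ (j + 1)) * ∑' n : ℕ+, cschCoeff n / (n : ℂ) ^ (2 * j + 1)) =
      2 * ∑ j ∈ Finset.range (p / 2), (1 + (-1 : ℂ) ^ (j + 1)) *
        altZeta ((2 * (j + 1) : ℕ) : ℂ) * riemannZeta ((p - 2 * j - 1 + 1 : ℕ) : ℂ) +
      4 * ∑ j ∈ Finset.range (p / 2), ∑ q ∈ pairsTwoTwo (2 * (j + 1)),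
        (-1 : ℂ) ^ q.2 * altZeta ((2 * q.1 : ℕ) : ℂ) * altZeta ((2 * q.2 : ℕ) : ℂ)
            * riemannZeta ((p - 2 * j - 1 + 1 : ℕ) : ℂ) := by
    rw [Finset.mul_sum, Finset.mul_sum, ← Finset.sum_add_distrib]
    refine Finset.sum_congr rfl fun j hj => ?_
    have hj' := Finset.mem_range.mp hj
    rw [tsum_cschCoeff_div_pow, ← Finset.sum_mul, show p - 2 * j - 1 + 1 = p - 2 * j by omega]
    ring
  -- Both sides vanish for odd p. For p = 2m this is `tsum_cschCoeff_div_pow` at j = m, and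
  -- rewriting the alternating value at p + 2 as a zeta value produces the factor 1 - 2^(-p-1).
  have heven : (1 + (-1 : ℂ) ^ p) * (1 - (-1) ^ (p / 2)) *
        ∑' n : ℕ+, cschCoeff n / (n : ℂ) ^ (p + 1) =
      -(riemannZeta ((p + 2 : ℕ) : ℂ) * ((1 - (2 : ℂ) ^ (-(p : ℤ) - 1)) * (1 + (-1) ^ p) *
        (1 + (-1) ^ (p / 2 + 1)))) - 2 * (1 + (-1 : ℂ) ^ p) * ∑ q ∈ pairsTwoTwo (p + 2),
          (-1 : ℂ) ^ q.2 * altZeta ((2 * q.1 : ℕ) : ℂ) * altZeta ((2 * q.2 : ℕ) : ℂ) := by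
    rcases Nat.even_or_odd p with he | ho
    · obtain ⟨m, rfl⟩ := he
      have hz := altZeta_eq_riemannZeta (k := m + m + 2) (by omega)
      have hexp : (1 : ℤ) - ((m + m + 2 : ℕ) : ℤ) = -((m + m : ℕ) : ℤ) - 1 := by push_cast; ring
      rw [hexp] at hz
      have hq := tsum_cschCoeff_div_pow m
      rw [show 2 * (m + 1) = m + m + 2 by ring, show 2 * m + 1 = m + m + 1 by ring, hz] at hq
      rw [(Even.add_self m).neg_one_pow, show (m + m) / 2 = m by omega]
      rw [pow_succ] at hq ⊢
      linear_combination -hq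
    · rw [ho.neg_one_pow]
      ring
  rw [hsum, heven]
  ring
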